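/- All $C^*$-algebras are complex and not necessarily unital; an ideal is a norm-closed two-sided ideal, a sub-$C^*$-algebra is a norm-closed ${}^*$-subalgebra, and $\overline{\mathbb{N}}=\{0,1,2,\ldots,\infty\}$. The minimal unitization $\widetilde{A}$ is $A$ itself if $A$ is unital, and the $C^*$-algebra obtained by adjoining a unit to $A$ otherwise. A family of sub-$C^*$-algebras $A_i\subset A$ \emph{approximates} $A$ if for every finite set $F\subset A$ and every $\varepsilon>0$ there is an $i$ such that every $x\in F$ satisfies $\|x-y\|<\varepsilon$ for some $y\in A_i$. For a topological space $X$, the covering dimension $\dim(X)$ is the smallest integer $n\ge 0$ such that every finite open cover of $X$ can be refined by a finite open cover in which no point of $X$ lies in more than $n+1$ different members ($\dim(X)=\infty$ if there is no such $n$). The local covering dimension $\operatorname{locdim}(X)$ is the smallest integer $n\geq 0$ such that every point of $X$ has a closed neighborhood $F$ with $\dim(F)\le n$ ($\operatorname{locdim}(X)=\infty$ if there is no such $n$). For a $C^*$-algebra $A$, $\operatorname{Prim}(A)$ is the set of primitive ideals of $A$ (kernels of nonzero irreducible ${}^*$-representations on Hilbert spaces) with the hull-kernel topology, whose closed sets are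 the sets $\{P : S\subseteq P\}$ for $S\subseteq A$. Let $\mathcal{C}$ be a class of $C^*$-algebras that is closed under ${}^*$-isomorphisms and under taking ideals, quotients, finite direct sums and minimal unitizations. A \emph{dimension theory} for $\mathcal{C}$ is an assignment $d\colon\mathcal{C}\to\overline{\mathbb{N}}$ such that $d(A)=d(A')$ whenever $A,A'\in\mathcal{C}$ are ${}^*$-isomorphic, and such that the following hold. (D1) $d(J)\leq d(A)$ whenever $J$ is an ideal of $A\in\mathcal{C}$. (D2) $d(A/J)\leq d(A)$ whenever $J$ is an ideal of $A\in\mathcal{C}$. (D3) $d(A\oplus B)=\max\{d(A),d(B)\}$ whenever $A,B\in\mathcal{C}$. (D4) $d(\widetilde{A})=d(A)$ whenever $A\in\mathcal{C}$. (D5) If $A\in\mathcal{C}$ is approximated by sub-$C^*$-algebras $A_i\in\mathcal{C}$ with $d(A_i)\leq n$ for all $i$, then $d(A)\leq n$. (D6) If $A\in\mathcal{C}$ and $C\subset A$ is a separable sub-$C^*$-algebra, then there is a separable sub-$C^*$-algebra $D\in\mathcal{C}$ with $C\subset D\subset A$ and $d(D)\leq d(A)$. \textbf{Proposition.} The class $\mathcal{C}^*_{\mathrm{ab}}$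 of commutative $C^*$-algebras is closed under ${}^*$-isomorphisms, ideals, quotients, finite direct sums and minimal unitizations, and the assignment $d\colon\mathcal{C}^*_{\mathrm{ab}}\to\overline{\mathbb{N}}$, $d(A)=\operatorname{locdim}(\operatorname{Prim}(A))$, is a dimension theory for $\mathcal{C}^*_{\mathrm{ab}}$. -/

import Mathlib

universe u

noncomputable section

open Topology

/-! ### Covering dimension and local covering dimension -/

/-- The order of a family `𝒰` of subsets of `X`: the largest `k` such that some point lies in `k`
different members of `𝒰` (`⊤` if there is no largest one, `0` if no point lies in any member). -/
def coverOrder {X : Type*} (𝒰 : Set (Set X)) : ℕ∞ :=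
  ⨆ x : X, {U ∈ 𝒰 | x ∈ U}.encard

/-- Finite open covers of `X`. -/
structure IsFiniteOpenCover {X : Type*} [TopologicalSpace X] (𝒰 : Set (Set X)) : Prop where
  finite : 𝒰.Finite
  isOpen : ∀ U ∈ 𝒰, IsOpen U
  cover : ⋃₀ 𝒰 = Set.univ

/-- The covering dimension of `X`: the smallest `n ≥ 0` such that every finite open cover can be
refined by a finite open cover of order at most `n + 1` (`⊤` if there is none). -/
def coveringDim (X : Type*) [TopologicalSpace X] : ℕ∞ :=
  ⨅ (n : ℕ) (_ : ∀ 𝒰 : Set (Set X), IsFiniteOpenCover 𝒰 →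
    ∃ 𝒱 : Set (Set X), IsFiniteOpenCover 𝒱 ∧ (∀ V ∈ 𝒱, ∃ U ∈ 𝒰, V ⊆ U) ∧
      coverOrder 𝒱 ≤ (n : ℕ∞) + 1), (n : ℕ∞)

/-- The local covering dimension of `X`: the smallest `n ≥ 0` such that every point has a closed
neighborhood of covering dimension at most `n` (`⊤` if there is none). -/
def locDim (X : Type*) [TopologicalSpace X] : ℕ∞ :=
  ⨅ (n : ℕ) (_ : ∀ x : X, ∃ F ∈ 𝓝 x, IsClosed F ∧ coveringDim F ≤ (n : ℕ∞)), (n : ℕ∞)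

/-! ### The primitive ideal space -/

section Prim

variable {A : Type u} [NonUnitalCStarAlgebra A]

/-- A `*`-representation on a Hilbert space is irreducible if it is nonzero and has no closed
invariant subspaces other than `0` and the whole space. -/
def IsIrreducibleRep {H : Type*} [NormedAddCommGroup H] [InnerProductSpace ℂ H] [CompleteSpace H]
    (π : A →⋆ₙₐ[ℂ] (H →L[ℂ] H)) : Prop :=
  π ≠ 0 ∧ ∀ K : Submodule ℂ H, IsClosed (K : Set H) → (∀ a : A, ∀ x ∈ K, π a x ∈ K) →
    K = ⊥ ∨ K = ⊤

/-- Primitive ideals: kernels of irreducible representations. (An irreducible representation is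
cyclic, so its Hilbert space has a copy in the universe of `A`.) -/
def IsPrimitiveIdeal (P : TwoSidedIdeal A) : Prop :=
  ∃ (H : Type u) (_ : NormedAddCommGroup H) (_ : InnerProductSpace ℂ H) (_ : CompleteSpace H)
    (π : A →⋆ₙₐ[ℂ] (H →L[ℂ] H)), IsIrreducibleRep π ∧ P = TwoSidedIdeal.ker π

variable (A) in
/-- The set of primitive ideals of `A`. -/
def PrimSpec : Type u := {P : TwoSidedIdeal A // IsPrimitiveIdeal P}

/-- The hull of a subset of `A`: all primitive ideals containing it. -/
def primHull (S : Set A) : Set (PrimSpec A) := {P | S ⊆ (P.1 : Set A)}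

/-- Primitive ideals are prime. -/
theorem IsPrimitiveIdeal.mem_or_mem {P : TwoSidedIdeal A} (hP : IsPrimitiveIdeal P) {x y : A}
    (h : ∀ a, x * a * y ∈ P) : x ∈ P ∨ y ∈ P := by
  obtain ⟨H, _, _, _, π, ⟨hπ0, hπ⟩, rfl⟩ := hP
  simp only [TwoSidedIdeal.mem_ker] at h ⊢
  have zero_of_ann : ∀ v : H, (∀ a, π a v = 0) → v = 0 := by
    let N : Submodule ℂ H :=
      { carrier := {v | ∀ a, π a v = 0}
        add_mem' := fun hv hw a => by simp [hv a, hw a]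
        zero_mem' := fun a => by simp
        smul_mem' := fun c v hv a => by simp [hv a] }
    have hNc : IsClosed (N : Set H) := by
      have : (N : Set H) = ⋂ a, {v | π a v = 0} := by ext v; simp [N]
      rw [this]
      exact isClosed_iInter fun a => isClosed_eq (π a).continuous continuous_const
    rcases hπ N hNc (fun a v hv b => by
      have : π b 0 = 0 := by simp
      rw [hv a, this]) with hN | hN
    · intro v hv
      have : v ∈ N := hv
      rw [hN] at this
      simpa using this
    · exact absurd (by
        ext a v
        have : v ∈ N := hN ▸ Submodule.mem_top
        simpa using this a) hπ0
  by_cases hy : π y = 0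
  · exact Or.inr hy
  left
  -- the closed subspace of vectors annihilated by all `π (x a)`
  let K : Submodule ℂ H :=
    { carrier := {v | ∀ a, π (x * a) v = 0}
      add_mem' := fun hv hw a => by simp only [map_add, hv a, hw a, add_zero]
      zero_mem' := fun a => by simp only [map_zero]
      smul_mem' := fun c v hv a => by simp only [map_smul, hv a, smul_zero] }
  have hKc : IsClosed (K : Set H) := by
    have : (K : Set H) = ⋂ a, {v | π (x * a) v = 0} := by ext v; simp [K]
    rw [this]
    exact isClosed_iInter fun a => isClosed_eq (π (x * a)).continuous continuous_const
  have hKinv : ∀ a : A, ∀ v ∈ K, π a v ∈ K := by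
    intro a v hv b
    have := hv (b * a)
    rw [← mul_assoc, map_mul] at this
    exact this
  have hyK : ∀ v, π y v ∈ K := by
    intro v a
    have := h a
    rw [map_mul] at this
    exact congrArg (fun T : H →L[ℂ] H => T v) this
  rcases hπ K hKc hKinv with hK | hK
  · refine absurd ?_ hy
    ext v
    have := hyK v
    rw [hK] at this
    simpa using this
  · have hx : ∀ a v, π x (π a v) = 0 := by
      intro a v
      have : v ∈ K := hK ▸ Submodule.mem_top
      have := this a
      rwa [map_mul] at this
    -- `π (star x)` has range orthogonal to everything, hence vanishes
    have hstar : ∀ v, π (star x) v = 0 := by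
      intro v
      apply zero_of_ann
      intro a
      apply ext_inner_left ℂ
      intro w
      have e1 : π a (π (star x) v) = star (π (x * star a)) v := by
        rw [← map_star, star_mul, star_star, map_mul]; rfl
      have e2 : π (x * star a) w = 0 := by rw [map_mul]; exact hx _ _
      rw [e1, ContinuousLinearMap.star_eq_adjoint, ContinuousLinearMap.adjoint_inner_right, e2]
      simp
    have h0 : π (star x) = 0 := by ext v; simpa using hstar v
    rw [map_star] at h0
    exact star_eq_zero.mp h0

/-- The hull-kernel topology: the closed sets are the hulls. -/
instance : TopologicalSpace (PrimSpec A) :=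
  TopologicalSpace.ofClosed {Z | ∃ S : Set A, Z = primHull S}
    ⟨Set.univ, by
      symm
      rw [Set.eq_empty_iff_forall_notMem]
      intro ⟨P, H, _, _, _, π, ⟨hπ0, _⟩, hPπ⟩ hP
      subst hPπ
      refine hπ0 ?_
      ext a : 1
      simpa [TwoSidedIdeal.mem_ker] using hP (Set.mem_univ a)⟩
    (by
      intro 𝒵 h𝒵
      refine ⟨{a | ∃ S : Set A, primHull S ∈ 𝒵 ∧ a ∈ S}, ?_⟩
      ext P
      constructor
      · rintro hP a ⟨S, hS, ha⟩
        exact hP _ hS ha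
      · intro hP Z hZ
        obtain ⟨S, rfl⟩ := h𝒵 hZ
        exact fun a ha => hP ⟨S, hZ, ha⟩)
    (by
      rintro _ ⟨S, rfl⟩ _ ⟨T, rfl⟩
      refine ⟨{z | ∃ x ∈ S, ∃ y ∈ T, ∃ a, z = x * a * y}, ?_⟩
      ext P
      constructor
      · rintro (h | h) _ ⟨x, hx, y, hy, a, rfl⟩
        · exact P.1.mul_mem_right _ _ (P.1.mul_mem_right _ _ (h hx))
        · exact P.1.mul_mem_left _ _ (h hy)
      · intro h
        by_contra hc
        rw [Set.mem_union, not_or] at hc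
        obtain ⟨x, hx, hxP⟩ := Set.not_subset.mp hc.1
        obtain ⟨y, hy, hyP⟩ := Set.not_subset.mp hc.2
        rcases P.2.mem_or_mem (x := x) (y := y) (fun a => h ⟨x, hx, y, hy, a, rfl⟩) with h' | h'
        · exact hxP h'
        · exact hyP h')

end Prim

/-! ### C*-algebras, sub-C*-algebras, ideals, quotients, direct sums, minimal unitizations -/

/-- (Complex, not necessarily unital) C*-algebras. -/
structure CStarAlg : Type (u + 1) where
  of ::
  carrier : Type u
  [str : NonUnitalCStarAlgebra carrier]

namespace CStarAlg

instance : CoeSort CStarAlg.{u} (Type u) := ⟨carrier⟩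

instance (A : CStarAlg.{u}) : NonUnitalCStarAlgebra A := A.str

/-- Sub-C*-algebras: norm-closed `*`-subalgebras. -/
structure Sub (A : CStarAlg.{u}) extends NonUnitalStarSubalgebra ℂ A where
  isClosed : IsClosed carrier

/-- A sub-C*-algebra as a C*-algebra. -/
def Sub.toCStarAlg {A : CStarAlg.{u}} (B : A.Sub) : CStarAlg.{u} :=
  haveI : IsClosed (B.toNonUnitalStarSubalgebra : Set A) := B.isClosed
  of B.toNonUnitalStarSubalgebra

/-- Ideals of a C*-algebra: norm-closed two-sided ideals. -/
structure CIdeal (A : CStarAlg.{u}) extends TwoSidedIdeal A where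
  isClosed : IsClosed (toTwoSidedIdeal : Set A)

section Ideal

variable {A : CStarAlg.{u}}

theorem norm_inr_sub_mul_le {A : Type*} [NonUnitalCStarAlgebra A] (e s z : A)
    (he : e = star s * s) (h1 : ‖e‖ ≤ 1) :
    ‖z - z * e‖ ≤ ‖z‖ := by
  let _ : PartialOrder (Unitization ℂ A) := CStarAlgebra.spectralOrder _
  let _ : StarOrderedRing (Unitization ℂ A) := CStarAlgebra.spectralOrderedRing _
  have h0 : (0 : Unitization ℂ A) ≤ (e : Unitization ℂ A) := by
    rw [he, Unitization.inr_mul, Unitization.inr_star]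
    exact star_mul_self_nonneg _
  have hmem : (e : Unitization ℂ A) ∈ Set.Icc 0 1 :=
    CStarAlgebra.mem_Icc_iff_norm_le_one.mpr ⟨h0, by rwa [Unitization.norm_inr]⟩
  have hmem' : 1 - (e : Unitization ℂ A) ∈ Set.Icc 0 1 := Set.sub_mem_Icc_zero_iff_right.mpr hmem
  have hn : ‖1 - (e : Unitization ℂ A)‖ ≤ 1 := (CStarAlgebra.mem_Icc_iff_norm_le_one.mp hmem').2
  calc ‖z - z * e‖ = ‖(z : Unitization ℂ A) * (1 - (e : Unitization ℂ A))‖ := by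
        rw [← Unitization.norm_inr (𝕜 := ℂ), Unitization.inr_sub, Unitization.inr_mul, mul_sub,
          mul_one]
    _ ≤ ‖(z : Unitization ℂ A)‖ * ‖1 - (e : Unitization ℂ A)‖ := norm_mul_le _ _
    _ ≤ ‖z‖ * 1 := by
        rw [Unitization.norm_inr]
        gcongr
    _ = ‖z‖ := mul_one _

/-- Closed star subalgebras contain positive contractions acting as approximate units on any given
element. -/
theorem Sub.exists_approx (B : A.Sub) {b : A} (hb : b ∈ B.toNonUnitalStarSubalgebra)
    {ε : ℝ} (hε : 0 < ε) :
    ∃ s : A, star s * s ∈ B.toNonUnitalStarSubalgebra ∧ ‖star s * s‖ ≤ 1 ∧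
      ‖b - b * (star s * s)‖ < ε := by
  let B' : CStarAlg.{u} := B.toCStarAlg
  let _ : PartialOrder B' := CStarAlgebra.spectralOrder _
  let _ : StarOrderedRing B' := CStarAlgebra.spectralOrderedRing _
  let b' : B' := ⟨b, hb⟩
  have hl := CStarAlgebra.increasingApproximateUnit B'
  have hε' : ∀ᶠ x in CStarAlgebra.approximateUnit B', ‖b' - b' * x‖ < ε := by
    have := Metric.tendsto_nhds.mp (hl.tendsto_mul_left b') ε hε
    filter_upwards [this] with x hx
    rwa [dist_comm, dist_eq_norm] at hx
  obtain ⟨x, hx0, hx1, hx⟩ :=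
    (hl.eventually_nonneg.and (hl.eventually_norm.and hε')).exists
  obtain ⟨s, rfl⟩ := CStarAlgebra.nonneg_iff_eq_star_mul_self.mp hx0
  refine ⟨(s : B.toNonUnitalStarSubalgebra).1, ?_, ?_, ?_⟩
  · exact (star s * s : B.toNonUnitalStarSubalgebra).2
  · exact hx1
  · exact hx

theorem CIdeal.smul_mem (J : A.CIdeal) (c : ℂ) {x : A} (hx : x ∈ J.toTwoSidedIdeal) :
    c • x ∈ J.toTwoSidedIdeal := by
  let T : A.Sub := ⟨⊤, isClosed_univ⟩
  have hcl : c • x ∈ closure (J.toTwoSidedIdeal : Set A) := by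
    rw [Metric.mem_closure_iff]
    intro ε hε
    obtain ⟨s, -, -, hs⟩ := T.exists_approx (b := c • x) trivial hε
    refine ⟨x * (c • (star s * s)), J.toTwoSidedIdeal.mul_mem_right _ _ hx, ?_⟩
    rwa [dist_eq_norm, mul_smul_comm, ← smul_mul_assoc]
  rwa [J.isClosed.closure_eq] at hcl

/-- The self-adjoint part `J ∩ J*` of a closed ideal. -/
def CIdeal.symmPart (J : A.CIdeal) : A.Sub where
  carrier := {x | x ∈ J.toTwoSidedIdeal ∧ star x ∈ J.toTwoSidedIdeal}
  add_mem' hx hy := ⟨add_mem hx.1 hy.1, by rw [star_add]; exact add_mem hx.2 hy.2⟩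
  zero_mem' := ⟨zero_mem _, by rw [star_zero]; exact zero_mem _⟩
  mul_mem' hx hy := ⟨J.toTwoSidedIdeal.mul_mem_left _ _ hy.1, by
    rw [star_mul]; exact J.toTwoSidedIdeal.mul_mem_left _ _ hx.2⟩
  smul_mem' c x hx := ⟨J.smul_mem c hx.1, by rw [star_smul]; exact J.smul_mem _ hx.2⟩
  star_mem' hx := ⟨hx.2, by rw [star_star]; exact hx.1⟩
  isClosed := J.isClosed.inter (J.isClosed.preimage continuous_star)

theorem norm_sub_mul_sq_le (z e s : A) (he : e = star s * s) (h1 : ‖e‖ ≤ 1) (b : A) :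
    ‖z - z * e‖ ^ 2 ≤ ‖star z * z + b‖ + ‖b - b * e‖ := by
  have hse : star e = e := by rw [he, star_mul, star_star]
  set w : A := star z * z with hw
  have key : star (z - z * e) * (z - z * e) =
      star (star (w + b - (w + b) * e) - star (w + b - (w + b) * e) * e)
        - star (star (b - b * e) - star (b - b * e) * e) := by
    simp only [star_sub, star_mul, star_star, hse, star_add, hw]
    noncomm_ring
  have bound : ∀ y : A, ‖star (star (y - y * e) - star (y - y * e) * e)‖ ≤ ‖y - y * e‖ := by
    intro y
    rw [norm_star]
    exact (norm_inr_sub_mul_le e s _ he h1).trans (norm_star _).le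
  calc ‖z - z * e‖ ^ 2 = ‖star (z - z * e) * (z - z * e)‖ := by
        rw [CStarRing.norm_star_mul_self, sq]
    _ ≤ ‖w + b - (w + b) * e‖ + ‖b - b * e‖ := by
        rw [key]
        exact (norm_sub_le _ _).trans (add_le_add (bound _) (bound _))
    _ ≤ ‖w + b‖ + ‖b - b * e‖ := by
        gcongr
        exact norm_inr_sub_mul_le e s _ he h1

/-- Closed ideals are self-adjoint. -/
theorem CIdeal.star_mem (J : A.CIdeal) {x : A} (hx : x ∈ J.toTwoSidedIdeal) :
    star x ∈ J.toTwoSidedIdeal := by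
  have hxx : x * star x ∈ J.symmPart.toNonUnitalStarSubalgebra := by
    have : x * star x ∈ J.toTwoSidedIdeal := J.toTwoSidedIdeal.mul_mem_right _ _ hx
    exact ⟨this, by rwa [star_mul, star_star]⟩
  have hcl : star x ∈ closure (J.toTwoSidedIdeal : Set A) := by
    rw [Metric.mem_closure_iff]
    intro ε hε
    obtain ⟨s, hs, hs1, hs2⟩ := J.symmPart.exists_approx hxx (ε := ε ^ 2) (by positivity)
    refine ⟨star x * (star s * s), J.toTwoSidedIdeal.mul_mem_left _ _ hs.1, ?_⟩
    rw [dist_eq_norm]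
    have := norm_sub_mul_sq_le (star x) _ s rfl hs1 (-(x * star x))
    rw [star_star, add_neg_cancel, norm_zero, zero_add] at this
    have h2 : ‖-(x * star x) - -(x * star x) * (star s * s)‖ =
        ‖x * star x - x * star x * (star s * s)‖ := by
      rw [neg_mul, neg_sub_neg, norm_sub_rev]
    rw [h2] at this
    exact lt_of_pow_lt_pow_left₀ 2 hε.le (this.trans_lt hs2)
  rwa [J.isClosed.closure_eq] at hcl

/-- A closed ideal as a sub-C*-algebra. -/
def CIdeal.toSub (J : A.CIdeal) : A.Sub where
  carrier := J.toTwoSidedIdeal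
  add_mem' hx hy := add_mem hx hy
  zero_mem' := zero_mem J.toTwoSidedIdeal
  mul_mem' _ hy := J.toTwoSidedIdeal.mul_mem_left _ _ hy
  smul_mem' c _ hx := J.smul_mem c hx
  star_mem' hx := J.star_mem hx
  isClosed := J.isClosed

/-- A closed ideal as a C*-algebra. -/
def CIdeal.toCStarAlg (J : A.CIdeal) : CStarAlg.{u} := J.toSub.toCStarAlg

/-- A closed ideal as a linear subspace. -/
def CIdeal.toSubmodule (J : A.CIdeal) : Submodule ℂ A := J.toSub.toSubmodule

instance (J : A.CIdeal) : IsClosed (J.toSubmodule : Set A) := J.isClosed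

/-- The quotient of a C*-algebra by a closed ideal, with the quotient norm. -/
def CIdeal.Quot (J : A.CIdeal) : Type u := A ⧸ J.toSubmodule

namespace CIdeal

variable (J : A.CIdeal)

instance : NormedAddCommGroup J.Quot := inferInstanceAs (NormedAddCommGroup (A ⧸ J.toSubmodule))
instance : NormedSpace ℂ J.Quot := inferInstanceAs (NormedSpace ℂ (A ⧸ J.toSubmodule))
instance : CompleteSpace J.Quot := inferInstanceAs (CompleteSpace (A ⧸ J.toSubmodule))

/-- The quotient map. -/
def proj : A →ₗ[ℂ] J.Quot := J.toSubmodule.mkQ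

theorem proj_surjective : Function.Surjective J.proj := J.toSubmodule.mkQ_surjective

theorem proj_eq_iff {x y : A} : J.proj x = J.proj y ↔ x - y ∈ J.toTwoSidedIdeal :=
  Submodule.Quotient.eq _

theorem norm_proj_le (x : A) : ‖J.proj x‖ ≤ ‖x‖ := Submodule.Quotient.norm_mk_le _ x

theorem exists_norm_lt (q : J.Quot) {ε : ℝ} (hε : 0 < ε) : ∃ x, J.proj x = q ∧ ‖x‖ < ‖q‖ + ε :=
  Submodule.Quotient.norm_mk_lt (S := J.toSubmodule) q hε

instance : Mul J.Quot where
  mul := Quotient.map₂ (· * ·) (by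
    intro a b hab c d hcd
    have h1 : J.proj a = J.proj b := Quotient.sound hab
    have h2 : J.proj c = J.proj d := Quotient.sound hcd
    have : J.proj (a * c) = J.proj (b * d) := by
      rw [proj_eq_iff] at h1 h2 ⊢
      rw [show a * c - b * d = a * (c - d) + (a - b) * d by noncomm_ring]
      exact add_mem (J.toTwoSidedIdeal.mul_mem_left _ _ h2) (J.toTwoSidedIdeal.mul_mem_right _ _ h1)
    exact Quotient.exact this)

instance : Star J.Quot where
  star := Quotient.map star (by
    intro a b hab
    have h1 : J.proj a = J.proj b := Quotient.sound hab
    have : J.proj (star a) = J.proj (star b) := by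
      rw [proj_eq_iff] at h1 ⊢
      rw [← star_sub]
      exact J.star_mem h1
    exact Quotient.exact this)

theorem proj_mul (x y : A) : J.proj (x * y) = J.proj x * J.proj y := rfl

theorem proj_star (x : A) : J.proj (star x) = star (J.proj x) := rfl

theorem norm_proj_sq_le (x : A) : ‖J.proj x‖ ^ 2 ≤ ‖J.proj (star x * x)‖ := by
  refine le_of_forall_pos_lt_add fun ε hε => ?_
  obtain ⟨y, hy, hyn⟩ := J.exists_norm_lt (J.proj (star x * x)) (half_pos hε)
  have hb : y - star x * x ∈ J.toTwoSidedIdeal := J.proj_eq_iff.mp hy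
  obtain ⟨s, hs, hs1, hs2⟩ := J.toSub.exists_approx (b := y - star x * x) hb (half_pos hε)
  have h := norm_sub_mul_sq_le x _ s rfl hs1 (y - star x * x)
  rw [add_sub_cancel] at h
  have hx : J.proj x = J.proj (x - x * (star s * s)) := by
    rw [proj_eq_iff, sub_sub_cancel]
    exact J.toTwoSidedIdeal.mul_mem_left _ _ hs
  have h' : ‖J.proj x‖ ^ 2 ≤ ‖x - x * (star s * s)‖ ^ 2 := by
    rw [hx]
    gcongr
    exact J.norm_proj_le _
  linarith

instance : NonUnitalRing J.Quot where
  left_distrib a b c := by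
    obtain ⟨a, rfl⟩ := J.proj_surjective a
    obtain ⟨b, rfl⟩ := J.proj_surjective b
    obtain ⟨c, rfl⟩ := J.proj_surjective c
    simp only [← map_add, ← proj_mul, mul_add]
  right_distrib a b c := by
    obtain ⟨a, rfl⟩ := J.proj_surjective a
    obtain ⟨b, rfl⟩ := J.proj_surjective b
    obtain ⟨c, rfl⟩ := J.proj_surjective c
    simp only [← map_add, ← proj_mul, add_mul]
  zero_mul a := by
    obtain ⟨a, rfl⟩ := J.proj_surjective a
    rw [← map_zero J.proj, ← proj_mul, zero_mul]
  mul_zero a := by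
    obtain ⟨a, rfl⟩ := J.proj_surjective a
    rw [← map_zero J.proj, ← proj_mul, mul_zero]
  mul_assoc a b c := by
    obtain ⟨a, rfl⟩ := J.proj_surjective a
    obtain ⟨b, rfl⟩ := J.proj_surjective b
    obtain ⟨c, rfl⟩ := J.proj_surjective c
    simp only [← proj_mul, mul_assoc]

instance : NonUnitalNormedRing J.Quot where
  dist_eq := NormedAddCommGroup.dist_eq
  norm_mul_le a b := by
    have H : ∀ ε : ℝ, 0 < ε → ‖a * b‖ ≤ (‖a‖ + ε) * (‖b‖ + ε) := by
      intro ε hε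
      obtain ⟨x, rfl, hx⟩ := J.exists_norm_lt a hε
      obtain ⟨y, rfl, hy⟩ := J.exists_norm_lt b hε
      rw [← proj_mul]
      calc ‖J.proj (x * y)‖ ≤ ‖x * y‖ := J.norm_proj_le _
        _ ≤ ‖x‖ * ‖y‖ := norm_mul_le _ _
        _ ≤ _ := by gcongr
    have hlim : Filter.Tendsto (fun ε : ℝ => (‖a‖ + ε) * (‖b‖ + ε)) (𝓝[>] 0)
        (𝓝 ((‖a‖ + 0) * (‖b‖ + 0))) := by
      apply Filter.Tendsto.mono_left _ nhdsWithin_le_nhds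
      exact (by fun_prop : Continuous fun ε : ℝ => (‖a‖ + ε) * (‖b‖ + ε)).tendsto 0
    rw [add_zero, add_zero] at hlim
    exact ge_of_tendsto hlim (by filter_upwards [self_mem_nhdsWithin] with ε hε using H ε hε)

instance : StarRing J.Quot where
  star_involutive a := by
    obtain ⟨a, rfl⟩ := J.proj_surjective a
    simp only [← proj_star, star_star]
  star_mul a b := by
    obtain ⟨a, rfl⟩ := J.proj_surjective a
    obtain ⟨b, rfl⟩ := J.proj_surjective b
    simp only [← proj_star, ← proj_mul, star_mul]
  star_add a b := by
    obtain ⟨a, rfl⟩ := J.proj_surjective a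
    obtain ⟨b, rfl⟩ := J.proj_surjective b
    simp only [← proj_star, ← map_add, star_add]

instance : CStarRing J.Quot where
  norm_mul_self_le a := by
    obtain ⟨a, rfl⟩ := J.proj_surjective a
    rw [← sq, ← proj_star, ← proj_mul]
    exact J.norm_proj_sq_le a

instance : IsScalarTower ℂ J.Quot J.Quot where
  smul_assoc c a b := by
    obtain ⟨a, rfl⟩ := J.proj_surjective a
    obtain ⟨b, rfl⟩ := J.proj_surjective b
    simp only [smul_eq_mul, ← map_smul, ← proj_mul, smul_mul_assoc]

instance : SMulCommClass ℂ J.Quot J.Quot where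
  smul_comm c a b := by
    obtain ⟨a, rfl⟩ := J.proj_surjective a
    obtain ⟨b, rfl⟩ := J.proj_surjective b
    simp only [smul_eq_mul, ← map_smul, ← proj_mul, mul_smul_comm]

instance : StarModule ℂ J.Quot where
  star_smul c a := by
    obtain ⟨a, rfl⟩ := J.proj_surjective a
    simp only [← map_smul, ← proj_star, star_smul]

instance : NonUnitalCStarAlgebra J.Quot where

/-- The quotient C*-algebra `A / J`. -/
def quotient : CStarAlg.{u} := of J.Quot

end CIdeal

end Ideal

/-- The direct sum `A ⊕ B`, with the maximum norm. -/
def directSum (A B : CStarAlg.{u}) : CStarAlg.{u} := of (A × B)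

/-- `A` has a multiplicative unit. -/
def IsUnital (A : CStarAlg.{u}) : Prop := ∃ e : A, ∀ a : A, e * a = a ∧ a * e = a

open Classical in
/-- The minimal unitization: `A` itself if `A` is unital, and otherwise the C*-algebra `A ⊕ ℂ1`
obtained by adjoining a unit. -/
def minUnitization (A : CStarAlg.{u}) : CStarAlg.{u} :=
  if A.IsUnital then A else of (Unitization ℂ A)

/-- A family of sub-C*-algebras approximates `A` if every finite subset of `A` is, up to any given
`ε > 0`, contained in some member of the family. -/
def Approximates {A : CStarAlg.{u}} (𝒮 : Set A.Sub) : Prop :=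
  ∀ (F : Finset A) (ε : ℝ), 0 < ε →
    ∃ B ∈ 𝒮, ∀ x ∈ F, ∃ y ∈ B.toNonUnitalStarSubalgebra, ‖x - y‖ < ε

end CStarAlg

/-! ### Dimension theories -/

/-- A class of C*-algebras closed under `*`-isomorphisms, ideals, quotients, finite direct sums and
minimal unitizations. -/
structure IsAdmissibleClass (𝒞 : Set CStarAlg.{u}) : Prop where
  iso : ∀ A B : CStarAlg.{u}, A ∈ 𝒞 → Nonempty (A ≃⋆ₐ[ℂ] B) → B ∈ 𝒞
  ideal : ∀ (A : CStarAlg.{u}) (J : A.CIdeal), A ∈ 𝒞 → J.toCStarAlg ∈ 𝒞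
  quotient : ∀ (A : CStarAlg.{u}) (J : A.CIdeal), A ∈ 𝒞 → J.quotient ∈ 𝒞
  directSum : ∀ A B : CStarAlg.{u}, A ∈ 𝒞 → B ∈ 𝒞 → A.directSum B ∈ 𝒞
  minUnitization : ∀ A : CStarAlg.{u}, A ∈ 𝒞 → A.minUnitization ∈ 𝒞

/-- `d` is a dimension theory for the class `𝒞` of C*-algebras. -/
structure IsDimensionTheory (𝒞 : Set CStarAlg.{u}) (d : 𝒞 → ℕ∞) : Prop where
  admissible : IsAdmissibleClass 𝒞
  iso_invariant : ∀ A B : 𝒞, Nonempty (A.1 ≃⋆ₐ[ℂ] B.1) → d A = d B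
  /-- (D1) -/
  ideal_le : ∀ (A : 𝒞) (J : A.1.CIdeal),
    d ⟨J.toCStarAlg, admissible.ideal A.1 J A.2⟩ ≤ d A
  /-- (D2) -/
  quotient_le : ∀ (A : 𝒞) (J : A.1.CIdeal),
    d ⟨J.quotient, admissible.quotient A.1 J A.2⟩ ≤ d A
  /-- (D3) -/
  directSum_eq : ∀ A B : 𝒞,
    d ⟨A.1.directSum B.1, admissible.directSum A.1 B.1 A.2 B.2⟩ = max (d A) (d B)
  /-- (D4) -/
  minUnitization_eq : ∀ A : 𝒞,
    d ⟨A.1.minUnitization, admissible.minUnitization A.1 A.2⟩ = d A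
  /-- (D5) -/
  approx_le : ∀ (A : 𝒞) (n : ℕ∞) (𝒮 : Set A.1.Sub), CStarAlg.Approximates 𝒮 →
    (∀ B ∈ 𝒮, ∃ hB : B.toCStarAlg ∈ 𝒞, d ⟨B.toCStarAlg, hB⟩ ≤ n) → d A ≤ n
  /-- (D6) -/
  separable : ∀ (A : 𝒞) (C : A.1.Sub), TopologicalSpace.SeparableSpace C.toCStarAlg →
    ∃ (D : A.1.Sub) (hD : D.toCStarAlg ∈ 𝒞), TopologicalSpace.SeparableSpace D.toCStarAlg ∧
      C.toNonUnitalStarSubalgebra ≤ D.toNonUnitalStarSubalgebra ∧ d ⟨D.toCStarAlg, hD⟩ ≤ d A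

/-- The class of commutative C*-algebras. -/
def commutativeCStarAlgs : Set CStarAlg.{u} := {A | ∀ a b : A, a * b = b * a}

end

/-! For a commutative `A`, let X(A) be the compact character space of `Unitization ℂ A`, and ∞ its
character with kernel `A`. By Gelfand duality `PrimSpec A` is X(A) ∖ {∞}, and
`CStarAlg.locDim_primSpec` shows that its local covering dimension is dim X(A): compact subsets of
X(A) ∖ {∞} are the closed subsets of X(A) missing ∞, and if these have dimension at most n then so
does X(A) (`CoverDimLE.of_forall_notMem`). As ∞ is adjoined whether or not `A` is unital, every
axiom becomes a statement about covering dimension of compact Hausdorff spaces.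

A quotient map induces a closed embedding of spectra, X(A ⊕ B) is the union of closed copies of X(A)
and X(B), and for a unital algebra ∞ is just one more closed point; the closed sum theorem
`CoverDimLE.union` handles the last two. An inclusion of a subalgebra B induces a surjection X(A) →
X(B) (`comap_surjective`), which for an ideal is injective off the fibre over ∞.

For (D5), functions subordinate to a given cover are moved into an approximating B, the resulting
cover is shrunk on X(B), and the shrinking is pulled back to X(A). For (D6), a shrinking of small
order is encoded by finitely many elements of the unitization; closing a countable set under the
algebraic operations and the choice of such witnesses, as in the Löwenheim–Skolem theorem, gives a
separable subalgebra of no larger dimension. -/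

open Topology

/-! ### Covering dimension of subsets -/

/-- Every finite family of open sets covering `S` can be shrunk to one covering `S` such that no
point of `S` lies in more than `n + 1` members. -/
def CoverDimLE {X : Type*} [TopologicalSpace X] (S : Set X) (n : ℕ) : Prop :=
  ∀ (k : ℕ) (U : Fin k → Set X), (∀ i, IsOpen (U i)) → (∀ x ∈ S, ∃ i, x ∈ U i) →
    ∃ V : Fin k → Set X, (∀ i, IsOpen (V i)) ∧ (∀ i, V i ⊆ U i) ∧ (∀ x ∈ S, ∃ i, x ∈ V i) ∧
      ∀ x ∈ S, {i | x ∈ V i}.encard ≤ (n : ℕ∞) + 1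

theorem ENat.iInf_natCast_le_iff {p : ℕ → Prop} (hp : ∀ m n, m ≤ n → p m → p n) (n : ℕ) :
    (⨅ (m : ℕ) (_ : p m), (m : ℕ∞)) ≤ n ↔ p n := by
  constructor
  · intro h
    by_contra hn
    have : ((n + 1 : ℕ) : ℕ∞) ≤ ⨅ (m : ℕ) (_ : p m), (m : ℕ∞) := by
      refine le_iInf₂ fun m hm => ?_
      have : n < m := by
        by_contra hmn
        exact hn (hp m n (not_lt.mp hmn) hm)
      exact_mod_cast this
    have := this.trans h
    norm_cast at this
    omega
  · intro h
    exact iInf₂_le n h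

theorem ENat.le_of_forall_natCast_le {a b : ℕ∞} (h : ∀ n : ℕ, b ≤ n → a ≤ n) : a ≤ b := by
  induction b using ENat.recTopCoe with
  | top => exact le_top
  | coe n => exact h n le_rfl

section CoverDim

variable {X Y : Type*} [TopologicalSpace X] [TopologicalSpace Y] {S T : Set X} {n : ℕ}

/-- A refinement becomes an indexed shrinking by uniting the members assigned to the same index;
conversely, forgetting indices can only merge members. Neither raises the order. -/
theorem coveringDim_le_iff : coveringDim X ≤ n ↔ CoverDimLE (Set.univ : Set X) n := by
  classical
  unfold coveringDim
  rw [ENat.iInf_natCast_le_iff]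
  · constructor
    · intro h k U hU hc
      obtain ⟨𝒱, h𝒱, href, hord⟩ := h (Set.range U) ⟨Set.finite_range U, by
        rintro _ ⟨i, rfl⟩; exact hU i, by
        rw [Set.sUnion_range, Set.eq_univ_iff_forall]
        simpa using hc⟩
      have hidx : ∀ V : 𝒱, ∃ i, (V : Set X) ⊆ U i := by
        rintro ⟨V, hV⟩
        obtain ⟨_, ⟨i, rfl⟩, hi⟩ := href V hV
        exact ⟨i, hi⟩
      choose g hg using hidx
      refine ⟨fun i => ⋃ (V : 𝒱) (_ : g V = i), (V : Set X), fun i => ?_, fun i => ?_,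
        fun x _ => ?_, fun x _ => ?_⟩
      · exact isOpen_iUnion fun V => isOpen_iUnion fun _ => h𝒱.isOpen V V.2
      · exact Set.iUnion₂_subset fun V hV => hV ▸ hg V
      · obtain ⟨V, hV, hx⟩ := Set.mem_sUnion.mp (h𝒱.cover.symm ▸ Set.mem_univ x : x ∈ ⋃₀ 𝒱)
        exact ⟨g ⟨V, hV⟩, Set.mem_iUnion₂.mpr ⟨⟨V, hV⟩, rfl, hx⟩⟩
      · refine le_trans ?_ ((le_iSup (fun x : X => {U ∈ 𝒱 | x ∈ U}.encard) x).trans hord)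
        -- The value outside `𝒱` is irrelevant; `hc` merely supplies some index.
        let G : Set X → Fin k := fun V => if h : V ∈ 𝒱 then g ⟨V, h⟩ else
          (hc x trivial).choose
        refine le_trans (Set.encard_le_encard ?_) (Set.encard_image_le G _)
        intro i hi
        obtain ⟨V, rfl, hx⟩ := Set.mem_iUnion₂.mp hi
        exact ⟨V, ⟨V.2, hx⟩, by simp [G]⟩
    · intro h 𝒰 h𝒰
      obtain ⟨k, U, hU⟩ : ∃ (k : ℕ) (U : Fin k → Set X), Set.range U = 𝒰 := by
        have := h𝒰.finite.to_subtype
        obtain ⟨k, ⟨e⟩⟩ := Finite.exists_equiv_fin 𝒰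
        exact ⟨k, fun i => (e.symm i : Set X), by
          rw [show (fun i => (e.symm i : Set X)) = Subtype.val ∘ e.symm from rfl,
            e.symm.surjective.range_comp, Subtype.range_val]⟩
      subst hU
      obtain ⟨V, hVo, hVU, hVc, hVn⟩ := h k U (fun i => h𝒰.isOpen _ ⟨i, rfl⟩) (fun x _ => by
        have := h𝒰.cover.symm ▸ Set.mem_univ x
        simpa using this)
      refine ⟨Set.range V, ⟨Set.finite_range V, ?_, ?_⟩, ?_, ?_⟩
      · rintro _ ⟨i, rfl⟩; exact hVo i
      · rw [Set.sUnion_range, Set.eq_univ_iff_forall]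
        simpa using hVc
      · rintro _ ⟨i, rfl⟩; exact ⟨_, ⟨i, rfl⟩, hVU i⟩
      · refine iSup_le fun x => le_trans ?_ (hVn x trivial)
        refine le_trans (Set.encard_le_encard ?_) (Set.encard_image_le V _)
        rintro _ ⟨⟨i, rfl⟩, hx⟩
        exact ⟨i, hx, rfl⟩
  · intro m m' hmm h 𝒰 h𝒰
    obtain ⟨𝒱, h1, h2, h3⟩ := h 𝒰 h𝒰
    exact ⟨𝒱, h1, h2, h3.trans (by gcongr)⟩

/-- Points outside the set are never counted, so open sets may be extended arbitrarily to the
ambient space: the notion is intrinsic to the subspace topology. -/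
theorem CoverDimLE.image_iff {f : Y → X} (hf : IsInducing f) {S : Set Y} :
    CoverDimLE (f '' S) n ↔ CoverDimLE S n := by
  constructor
  · intro h k U hU hc
    choose O hO hOU using fun i => hf.isOpen_iff.mp (hU i)
    obtain ⟨V, hVo, hVU, hVc, hVn⟩ := h k O hO (by
      rintro _ ⟨y, hy, rfl⟩
      obtain ⟨i, hi⟩ := hc y hy
      exact ⟨i, by rw [← hOU] at hi; exact hi⟩)
    exact ⟨fun i => f ⁻¹' V i, fun i => (hVo i).preimage hf.continuous,
      fun i => (Set.preimage_mono (hVU i)).trans (hOU i).subset,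
      fun y hy => hVc _ ⟨y, hy, rfl⟩, fun y hy => hVn _ ⟨y, hy, rfl⟩⟩
  · intro h k U hU hc
    obtain ⟨V, hVo, hVU, hVc, hVn⟩ := h k (fun i => f ⁻¹' U i)
      (fun i => (hU i).preimage hf.continuous) (fun y hy => hc _ ⟨y, hy, rfl⟩)
    choose O hO hOV using fun i => hf.isOpen_iff.mp (hVo i)
    have hmem : ∀ y i, f y ∈ O i ↔ y ∈ V i := fun y i => by rw [← hOV]; rfl
    refine ⟨fun i => O i ∩ U i, fun i => (hO i).inter (hU i), fun i => Set.inter_subset_right,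
      ?_, ?_⟩
    · rintro _ ⟨y, hy, rfl⟩
      obtain ⟨i, hi⟩ := hVc y hy
      exact ⟨i, (hmem y i).mpr hi, hVU i hi⟩
    · rintro _ ⟨y, hy, rfl⟩
      exact (Set.encard_le_encard fun i hi => (hmem y i).mp hi.1).trans (hVn y hy)

theorem CoverDimLE.coveringDim_subtype_iff : coveringDim S ≤ n ↔ CoverDimLE S n := by
  rw [coveringDim_le_iff, ← CoverDimLE.image_iff IsInducing.subtypeVal, Set.image_univ,
    Subtype.range_val]

theorem CoverDimLE.mono_closed (h : CoverDimLE T n) (hS : IsClosed S) (hST : S ⊆ T) :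
    CoverDimLE S n := by
  intro k U hU hc
  -- The complement of `S`, put at index 0, completes the cover to one of `T` and contains no point
  -- of `S`.
  obtain ⟨V, hVo, hVU, hVc, hVn⟩ := h (k + 1) (Fin.cons Sᶜ U)
    (Fin.cases hS.isOpen_compl hU) (fun x _ => by
      by_cases hx : x ∈ S
      · obtain ⟨i, hi⟩ := hc x hx
        exact ⟨i.succ, hi⟩
      · exact ⟨0, hx⟩)
  refine ⟨fun i => V i.succ, fun i => hVo _, fun i => hVU i.succ, fun x hx => ?_, fun x hx => ?_⟩
  · obtain ⟨i, hi⟩ := hVc x (hST hx)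
    induction i using Fin.cases with
    | zero => exact absurd hx (hVU 0 hi)
    | succ i => exact ⟨i, hi⟩
  · refine le_trans ?_ (hVn x (hST hx))
    rw [← (Fin.succ_injective k).encard_image]
    refine Set.encard_le_encard ?_
    rintro _ ⟨i, hi, rfl⟩
    exact hi

/-- An open cover of the space can be shrunk to have small order on a closed subset. -/
theorem CoverDimLE.exists_shrink (hS : CoverDimLE S n) (hSc : IsClosed S) {k : ℕ}
    {U : Fin k → Set X} (hU : ∀ i, IsOpen (U i)) (hc : ∀ x ∈ S ∪ T, ∃ i, x ∈ U i) :
    ∃ V : Fin k → Set X, (∀ i, IsOpen (V i)) ∧ (∀ i, V i ⊆ U i) ∧ (∀ x ∈ S ∪ T, ∃ i, x ∈ V i) ∧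
      ∀ x ∈ S, {i | x ∈ V i}.encard ≤ (n : ℕ∞) + 1 := by
  obtain ⟨W, hWo, hWU, hWc, hWn⟩ := hS k U hU fun x hx => hc x (Or.inl hx)
  -- Each `U i` is cut down to `W i` on `S` and left alone elsewhere; this is open because `S` is
  -- closed.
  refine ⟨fun i => U i ∩ (Sᶜ ∪ W i), fun i => (hU i).inter (hSc.isOpen_compl.union (hWo i)),
    fun i => Set.inter_subset_left, fun x hx => ?_, fun x hx => ?_⟩
  · by_cases hxS : x ∈ S
    · obtain ⟨i, hi⟩ := hWc x hxS
      exact ⟨i, hWU i hi, Or.inr hi⟩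
    · obtain ⟨i, hi⟩ := hc x hx
      exact ⟨i, hi, Or.inl hxS⟩
  · exact (Set.encard_le_encard fun i hi => hi.2.resolve_left fun h => h hx).trans (hWn x hx)

/-- Shrink for `S`, then shrink the result for `T`: further shrinking cannot raise the order already
achieved on `S`. -/
theorem CoverDimLE.union (hS : CoverDimLE S n) (hT : CoverDimLE T n) (hSc : IsClosed S)
    (hTc : IsClosed T) : CoverDimLE (S ∪ T) n := by
  intro k U hU hc
  obtain ⟨V, hVo, hVU, hVc, hVn⟩ := hS.exists_shrink hSc hU hc
  rw [Set.union_comm] at hVc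
  obtain ⟨W, hWo, hWV, hWc, hWn⟩ := hT.exists_shrink hTc hVo hVc
  rw [Set.union_comm] at hWc
  refine ⟨W, hWo, fun i => (hWV i).trans (hVU i), hWc, ?_⟩
  rintro x (hx | hx)
  · exact (Set.encard_le_encard fun i hi => hWV i hi).trans (hVn x hx)
  · exact hWn x hx

theorem CoverDimLE.of_subsingleton (hS : S.Subsingleton) : CoverDimLE S n := by
  classical
  intro k U hU hc
  rcases S.eq_empty_or_nonempty with rfl | ⟨x, hx⟩
  · exact ⟨U, hU, fun _ => subset_rfl, hc, by simp⟩
  · obtain ⟨i, hi⟩ := hc x hx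
    refine ⟨fun j => if j = i then U i else ∅, fun j => ?_, fun j => ?_, fun y hy => ⟨i, ?_⟩,
      fun y hy => ?_⟩
    · dsimp only
      split_ifs
      · exact hU i
      · exact isOpen_empty
    · dsimp only
      split_ifs with h
      · rw [h]
      · exact Set.empty_subset _
    · rw [hS hy hx]
      simpa using hi
    · refine (Set.encard_le_encard (t := {i}) fun j hj => ?_).trans ?_
      · by_contra h
        have h' : j ≠ i := h
        simp [h'] at hj
      · rw [Set.encard_singleton]
        exact le_add_self

theorem CoverDimLE.biUnion {ι : Type*} (t : Finset ι) {F : ι → Set X}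
    (hF : ∀ i ∈ t, IsClosed (F i)) (h : ∀ i ∈ t, CoverDimLE (F i) n) :
    CoverDimLE (⋃ i ∈ t, F i) n := by
  classical
  induction t using Finset.induction_on with
  | empty => simpa using CoverDimLE.of_subsingleton Set.subsingleton_empty
  | insert a t ha ih =>
    rw [Finset.set_biUnion_insert]
    refine (h a (by simp)).union (ih (fun i hi => hF i (by simp [hi]))
      (fun i hi => h i (by simp [hi]))) (hF a (by simp)) ?_
    exact t.finite_toSet.isClosed_biUnion fun i hi => hF i (by simp at hi; simp [hi])

/-- In a locally compact Hausdorff space, the local covering dimension is determined by the compact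
subsets. -/
theorem locDim_le_iff [T2Space X] [LocallyCompactSpace X] :
    locDim X ≤ n ↔ ∀ C : Set X, IsCompact C → CoverDimLE C n := by
  unfold locDim
  rw [ENat.iInf_natCast_le_iff]
  · constructor
    · intro h C hC
      choose F hF hFc hFn using h
      obtain ⟨t, -, ht⟩ := hC.elim_nhds_subcover F fun x _ => hF x
      exact (CoverDimLE.biUnion t (fun i _ => hFc i) fun i _ =>
        CoverDimLE.coveringDim_subtype_iff.mp (hFn i)).mono_closed hC.isClosed ht
    · intro h x
      obtain ⟨C, hC, hx⟩ := exists_compact_mem_nhds x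
      exact ⟨C, hx, hC.isClosed, CoverDimLE.coveringDim_subtype_iff.mpr (h C hC)⟩
  · intro m m' hmm h x
    obtain ⟨F, h1, h2, h3⟩ := h x
    exact ⟨F, h1, h2, h3.trans (by exact_mod_cast hmm)⟩

/-- A small neighborhood `V` of `p` is absorbed into a single member of the cover, and the
hypothesis is applied to the closed set `Vᶜ`. -/
theorem CoverDimLE.of_forall_notMem [NormalSpace X] [T1Space X] (p : X)
    (h : ∀ C : Set X, IsClosed C → p ∉ C → CoverDimLE C n) :
    CoverDimLE (Set.univ : Set X) n := by
  classical
  intro k U hU hc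
  obtain ⟨i₀, hi₀⟩ := hc p trivial
  obtain ⟨V, hVo, hpV, hVU⟩ := normal_exists_closure_subset (isClosed_singleton (x := p)) (hU i₀)
    (Set.singleton_subset_iff.mpr hi₀)
  obtain ⟨W, hWo, hWU, hWc, hWn⟩ := h Vᶜ hVo.isClosed_compl (fun h => h (hpV rfl)) k
    -- Removing `closure V` from all other members ensures that, once `V` is added to `W i₀`, points
    -- of `V` lie in that member only.
    (fun j => if j = i₀ then U i₀ else U j \ closure V)
    (fun j => by split_ifs; exacts [hU i₀, (hU j).sdiff isClosed_closure])
    (fun x _ => by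
      by_cases hx : x ∈ closure V
      · exact ⟨i₀, by simpa using hVU hx⟩
      · obtain ⟨j, hj⟩ := hc x trivial
        refine ⟨j, ?_⟩
        split_ifs with h
        · exact h ▸ hj
        · exact ⟨hj, hx⟩)
  refine ⟨fun j => if j = i₀ then V ∪ W i₀ else W j, fun j => ?_, fun j => ?_, fun x _ => ?_,
    fun x _ => ?_⟩
  · dsimp only
    split_ifs
    exacts [hVo.union (hWo _), hWo j]
  · have := hWU j
    dsimp only
    split_ifs with hj
    · subst hj
      rw [if_pos rfl] at this
      exact Set.union_subset (subset_closure.trans hVU) this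
    · rw [if_neg hj] at this
      exact this.trans Set.sdiff_subset
  · by_cases hx : x ∈ V
    · exact ⟨i₀, by simp [hx]⟩
    · obtain ⟨j, hj⟩ := hWc x hx
      refine ⟨j, ?_⟩
      dsimp only
      split_ifs with h
      · exact Or.inr (h ▸ hj)
      · exact hj
  · by_cases hx : x ∈ V
    · refine (Set.encard_le_encard (t := {i₀}) fun j hj => ?_).trans ?_
      · by_contra hji
        have hji : j ≠ i₀ := hji
        have h1 : x ∈ W j := by simpa [hji] using hj
        have h2 := hWU j h1
        rw [if_neg hji] at h2
        exact h2.2 (subset_closure hx)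
      · rw [Set.encard_singleton]
        exact le_add_self
    · refine (Set.encard_le_encard fun j hj => ?_).trans (hWn x hx)
      by_cases hji : j = i₀
      · subst hji
        simpa [hx] using hj
      · simpa [hji] using hj

/-- The shrinking lemma gives closed sets inside the `U i` that still cover; Urysohn functions equal
to 1 on them suffice, so no partition of unity is needed. -/
theorem exists_continuousMap_subordinate [NormalSpace X] {k : ℕ} {U : Fin k → Set X}
    (hU : ∀ i, IsOpen (U i)) (hc : ∀ x, ∃ i, x ∈ U i) :
    ∃ f : Fin k → C(X, ℂ), (∀ i x, x ∉ U i → f i x = 0) ∧ ∀ x, ∃ i, f i x = 1 := by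
  obtain ⟨F, hFc, hFcl, hFU⟩ := exists_iUnion_eq_closed_subset hU
    (fun x => Set.toFinite _) (Set.eq_univ_iff_forall.mpr fun x => by simpa using hc x)
  have := fun i => exists_continuous_zero_one_of_isClosed (hU i).isClosed_compl (hFcl i)
    (Set.disjoint_compl_left_iff_subset.mpr (hFU i))
  choose g hg0 hg1 _ using this
  refine ⟨fun i => ⟨fun x => (g i x : ℂ), by fun_prop⟩, fun i x hx => ?_, fun x => ?_⟩
  · simpa using hg0 i hx
  · obtain ⟨i, hi⟩ := Set.mem_iUnion.mp (hFc.symm ▸ Set.mem_univ x : x ∈ ⋃ i, F i)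
    exact ⟨i, by simpa using hg1 i hi⟩

/-- It suffices to shrink covers by sets `{1 / 2 < re f}` with `f` from a family approximating
all continuous functions. -/
theorem CoverDimLE.of_approx [CompactSpace X] [NormalSpace X]
    (h : ∀ (k : ℕ) (p : Fin k → C(X, ℂ)), ∃ f : Fin k → C(X, ℂ), (∀ i, ‖p i - f i‖ < 1 / 2) ∧
      ((∀ x, ∃ i, 1 / 2 < (f i x).re) → ∃ V : Fin k → Set X, (∀ i, IsOpen (V i)) ∧
        (∀ i, ∀ x ∈ V i, 1 / 2 < (f i x).re) ∧ (∀ x, ∃ i, x ∈ V i) ∧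
        ∀ x, {i | x ∈ V i}.encard ≤ (n : ℕ∞) + 1)) :
    CoverDimLE (Set.univ : Set X) n := by
  intro k U hU hc
  obtain ⟨p, hp0, hp1⟩ := exists_continuousMap_subordinate hU fun x => hc x trivial
  obtain ⟨f, hpf, hf⟩ := h k p
  -- With error below 1/2, `re f` exceeds 1/2 where `p` is 1 and stays below 1/2 where `p` is 0.
  -- Hence the sets `{1 / 2 < re f}` cover and lie inside the `U i`.
  have key : ∀ i x, |(p i x).re - (f i x).re| < 1 / 2 := fun i x =>
    calc |(p i x).re - (f i x).re| = |((p i - f i) x).re| := by simp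
      _ ≤ ‖(p i - f i) x‖ := Complex.abs_re_le_norm _
      _ ≤ ‖p i - f i‖ := ContinuousMap.norm_coe_le_norm _ _
      _ < 1 / 2 := hpf i
  obtain ⟨V, hVo, hVf, hVc, hVn⟩ := hf fun x => by
    obtain ⟨i, hi⟩ := hp1 x
    have := (abs_lt.mp (key i x)).2
    rw [hi, Complex.one_re] at this
    exact ⟨i, by linarith⟩
  refine ⟨V, hVo, fun i x hx => ?_, fun x _ => hVc x, fun x _ => hVn x⟩
  by_contra hxU
  have h1 := (abs_lt.mp (key i x)).1
  rw [hp0 i x hxU, Complex.zero_re] at h1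
  linarith [hVf i x hx]

end CoverDim

/-! ### Characters of the unitization and Gelfand duality -/

open WeakDual

/-- The character space of the unitization of `A`, a one-point compactification of the space of
characters of `A`. -/
abbrev UnitizedSpectrum (A : Type*) [NonUnitalCStarAlgebra A] :=
  characterSpace ℂ (Unitization ℂ A)

namespace UnitizedSpectrum

section General

variable {A B : Type*} [NonUnitalCStarAlgebra A] [NonUnitalCStarAlgebra B]

/-- The character of the unitization with kernel `A`. -/
noncomputable def infty (A : Type*) [NonUnitalCStarAlgebra A] : UnitizedSpectrum A :=
  CharacterSpace.equivAlgHom.symm (Unitization.fstHom ℂ A)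

@[simp]
theorem infty_apply (x : Unitization ℂ A) : infty A x = x.fst := rfl

theorem apply_eq (χ : UnitizedSpectrum A) (x : Unitization ℂ A) :
    χ x = x.fst + χ (x.snd : Unitization ℂ A) := by
  conv_lhs => rw [← Unitization.inl_fst_add_inr_snd_eq x]
  rw [map_add]
  congr 1
  exact AlgHomClass.commutes χ x.fst

theorem ext_inr {χ ψ : UnitizedSpectrum A}
    (h : ∀ a : A, χ (a : Unitization ℂ A) = ψ (a : Unitization ℂ A)) : χ = ψ :=
  CharacterSpace.ext fun x => by rw [apply_eq χ, apply_eq ψ, h]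

theorem inr_mul (χ : UnitizedSpectrum A) (a b : A) :
    χ ((a * b : A) : Unitization ℂ A) = χ (a : Unitization ℂ A) * χ (b : Unitization ℂ A) := by
  rw [Unitization.inr_mul, map_mul]

theorem inr_add (χ : UnitizedSpectrum A) (a b : A) :
    χ ((a + b : A) : Unitization ℂ A) = χ (a : Unitization ℂ A) + χ (b : Unitization ℂ A) := by
  rw [Unitization.inr_add, map_add]

theorem inr_smul (χ : UnitizedSpectrum A) (c : ℂ) (a : A) :
    χ ((c • a : A) : Unitization ℂ A) = c * χ (a : Unitization ℂ A) := by
  rw [Unitization.inr_smul, map_smul, smul_eq_mul]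

theorem inr_star (χ : UnitizedSpectrum A) (a : A) :
    χ ((star a : A) : Unitization ℂ A) = star (χ (a : Unitization ℂ A)) := by
  rw [Unitization.inr_star, map_star]

theorem continuous_apply (x : Unitization ℂ A) : Continuous fun χ : UnitizedSpectrum A => χ x :=
  (gelfandTransform ℂ (Unitization ℂ A) x).continuous

theorem norm_apply_inr_le (χ : UnitizedSpectrum A) (a : A) : ‖χ (a : Unitization ℂ A)‖ ≤ ‖a‖ := by
  have h := spectrum.norm_le_norm_of_mem
    (CharacterSpace.apply_mem_spectrum χ (a : Unitization ℂ A))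
  rwa [Unitization.norm_inr] at h

theorem exists_ne_zero_of_ne_infty {χ : UnitizedSpectrum A} (h : χ ≠ infty A) :
    ∃ a : A, χ (a : Unitization ℂ A) ≠ 0 := by
  by_contra! hc
  exact h (ext_inr fun a => by rw [hc a]; simp)

/-- The map on spectra induced by a `*`-homomorphism. -/
noncomputable def comap (φ : A →⋆ₙₐ[ℂ] B) : C(UnitizedSpectrum B, UnitizedSpectrum A) :=
  CharacterSpace.compContinuousMap (Unitization.starMap φ)

theorem comap_apply (φ : A →⋆ₙₐ[ℂ] B) (χ : UnitizedSpectrum B) (x : Unitization ℂ A) :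
    comap φ χ x = χ (Unitization.starMap φ x) := rfl

@[simp]
theorem comap_apply_inr (φ : A →⋆ₙₐ[ℂ] B) (χ : UnitizedSpectrum B) (a : A) :
    comap φ χ (a : Unitization ℂ A) = χ (φ a : Unitization ℂ B) := by
  rw [comap_apply, Unitization.starMap_inr]

@[simp]
theorem comap_infty (φ : A →⋆ₙₐ[ℂ] B) : comap φ (infty B) = infty A :=
  ext_inr fun a => by simp

theorem comap_injective {φ : A →⋆ₙₐ[ℂ] B} (hφ : Function.Surjective φ) :
    Function.Injective (comap φ) := by
  intro χ ψ h
  refine ext_inr fun b => ?_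
  obtain ⟨a, rfl⟩ := hφ b
  rw [← comap_apply_inr, h, comap_apply_inr]

theorem isClosedEmbedding_comap {φ : A →⋆ₙₐ[ℂ] B} (hφ : Function.Surjective φ) :
    IsClosedEmbedding (comap φ) :=
  (comap φ).continuous.isClosedEmbedding (comap_injective hφ)

end General

section Comm

variable {A B : Type*} [NonUnitalCStarAlgebra A] [NonUnitalCStarAlgebra B]

theorem exists_apply_eq (hA : ∀ a b : A, a * b = b * a) (f : C(UnitizedSpectrum A, ℂ)) :
    ∃ x : Unitization ℂ A, ∀ χ : UnitizedSpectrum A, χ x = f χ := by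
  let _ : NonUnitalCommCStarAlgebra A := { mul_comm := hA }
  obtain ⟨x, hx⟩ := (gelfandTransform_bijective (Unitization ℂ A)).2 f
  exact ⟨x, fun χ => congr($hx χ)⟩

theorem eq_zero_of_forall_apply (hA : ∀ a b : A, a * b = b * a) {a : A}
    (h : ∀ χ : UnitizedSpectrum A, χ (a : Unitization ℂ A) = 0) : a = 0 := by
  let _ : NonUnitalCommCStarAlgebra A := { mul_comm := hA }
  refine Unitization.inr_injective (R := ℂ) ?_
  refine (gelfandTransform_bijective (Unitization ℂ A)).1 ?_
  ext χ
  exact (h χ).trans (by simp)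

/-- Urysohn's lemma combined with Gelfand duality; requiring ∞ in `Z` is what places the separating
element in `A` rather than only in its unitization. -/
theorem exists_separating (hA : ∀ a b : A, a * b = b * a) {Z : Set (UnitizedSpectrum A)}
    (hZ : IsClosed Z) (hi : infty A ∈ Z) {χ : UnitizedSpectrum A} (hχ : χ ∉ Z) :
    ∃ a : A, χ (a : Unitization ℂ A) = 1 ∧ ∀ ψ ∈ Z, ψ (a : Unitization ℂ A) = 0 := by
  obtain ⟨g, hg0, hg1, -⟩ := exists_continuous_zero_one_of_isClosed hZ
    (isClosed_singleton (x := χ)) (Set.disjoint_singleton_right.mpr hχ)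
  obtain ⟨x, hx⟩ := exists_apply_eq hA ⟨fun ψ => (g ψ : ℂ), by fun_prop⟩
  have hfst : x.fst = 0 := by
    have := hx (infty A)
    rw [infty_apply] at this
    rw [this]
    simpa using hg0 hi
  have hinr : ∀ ψ : UnitizedSpectrum A, ψ (x.snd : Unitization ℂ A) = g ψ := fun ψ => by
    have := apply_eq ψ x
    rw [hfst, zero_add] at this
    rw [← this, hx]
    rfl
  refine ⟨x.snd, ?_, fun ψ hψ => ?_⟩
  · rw [hinr, hg1 rfl]
    simp
  · rw [hinr, hg0 hψ]
    simp

/-- The range is closed and contains ∞. A character outside it would be separated from it by some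
`a` killed by every character of `B` composed with `φ`, so `φ a = 0` although `a ≠ 0`. -/
theorem comap_surjective (hA : ∀ a b : A, a * b = b * a) (hB : ∀ a b : B, a * b = b * a)
    {φ : A →⋆ₙₐ[ℂ] B} (hφ : Function.Injective φ) : Function.Surjective (comap φ) := by
  intro χ
  by_contra hχ
  obtain ⟨a, ha, h0⟩ := exists_separating hA (isCompact_range (comap φ).continuous).isClosed
    ⟨infty B, comap_infty φ⟩ (χ := χ) hχ
  have hφa : φ a = 0 := eq_zero_of_forall_apply hB fun ψ => by
    rw [← comap_apply_inr]
    exact h0 _ ⟨ψ, rfl⟩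
  rw [← map_zero φ] at hφa
  rw [hφ hφa] at ha
  simp at ha

end Comm

/-! ### Primitive ideals of commutative C*-algebras -/

section Prim

variable {A : Type u} [NonUnitalCStarAlgebra A]

section Rep

variable (H : Type*) [NormedAddCommGroup H] [InnerProductSpace ℂ H] [CompleteSpace H]

/-- The representation of `A` by scalars given by a character. -/
noncomputable def rep (χ : UnitizedSpectrum A) : A →⋆ₙₐ[ℂ] (H →L[ℂ] H) where
  toFun a := χ (a : Unitization ℂ A) • 1
  map_smul' c a := by rw [inr_smul, mul_smul]; rfl
  map_zero' := by simp
  map_add' a b := by rw [inr_add, add_smul]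
  map_mul' a b := by rw [inr_mul, smul_mul_smul_comm, one_mul]
  map_star' a := by rw [inr_star, star_smul, star_one]

variable {H}

theorem rep_eq_zero_iff [Nontrivial H] (χ : UnitizedSpectrum A) (a : A) :
    rep H χ a = 0 ↔ χ (a : Unitization ℂ A) = 0 := by
  change χ (a : Unitization ℂ A) • (1 : H →L[ℂ] H) = 0 ↔ _
  rw [smul_eq_zero, or_iff_left one_ne_zero]

theorem isIrreducibleRep_rep (hH : Module.finrank ℂ H = 1) {χ : UnitizedSpectrum A}
    (h : χ ≠ infty A) : IsIrreducibleRep (rep H χ) := by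
  have : Nontrivial H := Module.nontrivial_of_finrank_eq_succ hH
  refine ⟨fun h0 => ?_, fun K _ _ => ?_⟩
  · obtain ⟨a, ha⟩ := exists_ne_zero_of_ne_infty h
    exact ha ((rep_eq_zero_iff χ a).mp (by rw [h0]; rfl))
  · have : IsSimpleModule ℂ H := isSimpleModule_iff_finrank_eq_one.mpr hH
    exact eq_bot_or_eq_top K

end Rep

/-- The primitive ideal given by a character. -/
noncomputable def toPrimSpec (χ : ({infty A}ᶜ : Set (UnitizedSpectrum A))) : PrimSpec A :=
  -- A one-dimensional Hilbert space in the universe of `A`, as `IsPrimitiveIdeal` demands.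
  ⟨TwoSidedIdeal.ker (rep (EuclideanSpace ℂ PUnit.{u + 1}) χ.1), _, _, _, _, _,
    isIrreducibleRep_rep (by simp) χ.2, rfl⟩

theorem mem_toPrimSpec {χ : ({infty A}ᶜ : Set (UnitizedSpectrum A))} {a : A} :
    a ∈ (toPrimSpec χ).1 ↔ χ.1 (a : Unitization ℂ A) = 0 := by
  rw [← rep_eq_zero_iff (H := EuclideanSpace ℂ PUnit.{u + 1})]
  exact TwoSidedIdeal.mem_ker _

theorem isClosed_primSpec_iff {Z : Set (PrimSpec A)} : IsClosed Z ↔ ∃ S : Set A, Z = primHull S := by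
  rw [← isOpen_compl_iff]
  change Zᶜᶜ ∈ {Z | ∃ S : Set A, Z = primHull S} ↔ _
  rw [compl_compl]
  rfl

theorem continuous_toPrimSpec : Continuous (toPrimSpec (A := A)) := by
  refine continuous_iff_isClosed.mpr fun Z hZ => ?_
  obtain ⟨S, rfl⟩ := isClosed_primSpec_iff.mp hZ
  have : toPrimSpec ⁻¹' primHull S = ⋂ a ∈ S,
      {χ : ({infty A}ᶜ : Set (UnitizedSpectrum A)) | χ.1 (a : Unitization ℂ A) = 0} := by
    ext χ
    rw [Set.mem_iInter₂]
    exact forall₂_congr fun a _ => mem_toPrimSpec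
  rw [this]
  exact isClosed_biInter fun a _ =>
    isClosed_eq ((continuous_apply _).comp continuous_subtype_val) continuous_const

theorem toPrimSpec_injective (hA : ∀ a b : A, a * b = b * a) :
    Function.Injective (toPrimSpec (A := A)) := by
  intro χ ψ h
  by_contra hne
  obtain ⟨a, ha, h0⟩ := exists_separating hA (Z := {infty A, ψ.1}) (Set.toFinite _).isClosed
    (by simp) (χ := χ.1) (by
      rintro (h | h)
      · exact χ.2 h
      · exact hne (Subtype.ext h))
  have : a ∈ (toPrimSpec χ).1 := h ▸ mem_toPrimSpec.mpr (h0 _ (by simp))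
  rw [mem_toPrimSpec, ha] at this
  exact one_ne_zero this

end Prim

end UnitizedSpectrum

namespace CStarAlg

variable {A : CStarAlg.{u}}

open UnitizedSpectrum

/-- The quotient map as a `*`-homomorphism. -/
noncomputable def CIdeal.projHom (J : A.CIdeal) : A →⋆ₙₐ[ℂ] J.Quot where
  toFun := J.proj
  map_smul' := map_smul J.proj
  map_zero' := map_zero J.proj
  map_add' := map_add J.proj
  map_mul' := J.proj_mul
  map_star' := J.proj_star

theorem CIdeal.quot_mul_comm (J : A.CIdeal) (hA : ∀ a b : A, a * b = b * a) (a b : J.Quot) :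
    a * b = b * a := by
  obtain ⟨a, rfl⟩ := J.proj_surjective a
  obtain ⟨b, rfl⟩ := J.proj_surjective b
  rw [← J.proj_mul, hA, J.proj_mul]

/-- Primeness replaces Schur's lemma: the commutative quotient by a primitive ideal has exactly one
character besides ∞, and that character pulls back to the required one. -/
theorem toPrimSpec_surjective (hA : ∀ a b : A, a * b = b * a) :
    Function.Surjective (toPrimSpec (A := A)) := by
  rintro ⟨P, hP⟩
  have hP' := hP
  obtain ⟨H, _, _, _, π, ⟨hπ0, -⟩, hPπ⟩ := hP'
  have hmem : ∀ a, a ∈ P ↔ π a = 0 := fun a => by rw [hPπ]; exact TwoSidedIdeal.mem_ker _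
  let J : A.CIdeal := ⟨P, by
    have : (P : Set A) = π ⁻¹' {0} := by ext a; exact hmem a
    rw [this]
    exact isClosed_singleton.preimage (AddMonoidHomClass.continuous_of_bound π 1 fun a => by
      simpa using NonUnitalStarAlgHom.norm_apply_le π a)⟩
  have hproj : ∀ a, J.proj a = 0 ↔ a ∈ P := fun a => by
    rw [← map_zero J.proj, J.proj_eq_iff, sub_zero]
  have hQ := J.quot_mul_comm hA
  obtain ⟨χ, hχ⟩ : ∃ χ : UnitizedSpectrum J.Quot, χ ≠ infty _ := by
    by_contra! hc
    refine hπ0 ?_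
    ext a : 1
    refine (hmem a).mp ((hproj a).mp (eq_zero_of_forall_apply hQ fun ψ => ?_))
    rw [hc ψ]
    simp
  -- Two such characters would have disjoint neighborhoods, hence nonzero `p` and `q` with `p * c *
  -- q = 0` for all `c`, contradicting primeness of `P`.
  have huniq : ∀ ψ : UnitizedSpectrum J.Quot, ψ ≠ infty _ → ψ = χ := by
    intro ψ hψ
    by_contra hne
    obtain ⟨U, V, hU, hV, hψU, hχV, hUV⟩ := t2_separation hne
    obtain ⟨p, hp, hp0⟩ := exists_separating hQ (hU.isClosed_compl.union isClosed_singleton)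
      (Or.inr rfl) (χ := ψ) (by simp [hψU, hψ])
    obtain ⟨q, hq, hq0⟩ := exists_separating hQ (hV.isClosed_compl.union isClosed_singleton)
      (Or.inr rfl) (χ := χ) (by simp [hχV, hχ])
    obtain ⟨a, rfl⟩ := J.proj_surjective p
    obtain ⟨b, rfl⟩ := J.proj_surjective q
    have : ∀ c, a * c * b ∈ P := by
      intro c
      rw [← hproj, J.proj_mul, J.proj_mul]
      refine eq_zero_of_forall_apply hQ fun θ => ?_
      rw [inr_mul, inr_mul]
      by_cases hθ : θ ∈ U
      · rw [hq0 θ (Or.inl fun h => Set.disjoint_left.mp hUV hθ h), mul_zero]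
      · rw [hp0 θ (Or.inl hθ), zero_mul, zero_mul]
    rcases hP.mem_or_mem this with h | h
    · rw [(hproj a).mpr h] at hp
      simp at hp
    · rw [(hproj b).mpr h] at hq
      simp at hq
  have hχ' : comap J.projHom χ ≠ infty A := fun h =>
    hχ (comap_injective J.proj_surjective (h.trans (comap_infty _).symm))
  refine ⟨⟨_, hχ'⟩, Subtype.ext ?_⟩
  ext a
  rw [mem_toPrimSpec, comap_apply_inr]
  change χ (J.proj a : Unitization ℂ J.Quot) = 0 ↔ a ∈ P
  rw [← hproj]
  refine ⟨fun h => eq_zero_of_forall_apply hQ fun ψ => ?_, fun h => by rw [h]; simp⟩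
  by_cases hψ : ψ = infty _
  · rw [hψ]
    simp
  · rw [huniq ψ hψ, h]

/-- The image is the hull of the elements vanishing on `C'`: a character outside `C'` and different
from ∞ is separated from both by such an element. -/
theorem isClosedMap_toPrimSpec (hA : ∀ a b : A, a * b = b * a) :
    IsClosedMap (toPrimSpec (A := A)) := by
  intro C hC
  obtain ⟨C', hC', rfl⟩ := isClosed_induced_iff.mp hC
  rw [isClosed_primSpec_iff]
  refine ⟨{a | ∀ χ ∈ C', χ (a : Unitization ℂ A) = 0}, ?_⟩
  ext P
  constructor
  · rintro ⟨χ, hχ, rfl⟩ a ha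
    exact mem_toPrimSpec.mpr (ha _ hχ)
  · intro hP
    obtain ⟨χ, rfl⟩ := toPrimSpec_surjective hA P
    refine ⟨χ, ?_, rfl⟩
    by_contra hχ
    obtain ⟨a, ha, h0⟩ := exists_separating hA (hC'.union isClosed_singleton) (Or.inr rfl)
      (χ := χ.1) (by
        rintro (h | h)
        exacts [hχ h, χ.2 h])
    have := mem_toPrimSpec.mp (hP fun ψ hψ => h0 ψ (Or.inl hψ))
    rw [ha] at this
    exact one_ne_zero this

/-- The primitive ideal space of a commutative C*-algebra is its space of characters. -/
noncomputable def primSpecHomeo (hA : ∀ a b : A, a * b = b * a) :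
    ({infty A}ᶜ : Set (UnitizedSpectrum A)) ≃ₜ PrimSpec A :=
  (Equiv.ofBijective _ ⟨toPrimSpec_injective hA, toPrimSpec_surjective hA⟩).toHomeomorphOfContinuousClosed
    continuous_toPrimSpec (isClosedMap_toPrimSpec hA)

/-- Both sides are governed by the closed subsets of the spectrum that miss ∞, which are exactly the
compact subsets of its complement. -/
theorem locDim_primSpec (hA : ∀ a b : A, a * b = b * a) :
    locDim (PrimSpec A) = coveringDim (UnitizedSpectrum A) := by
  let e := primSpecHomeo hA
  have : LocallyCompactSpace ({infty A}ᶜ : Set (UnitizedSpectrum A)) :=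
    (isOpen_compl_singleton (x := infty A)).locallyCompactSpace
  have := e.locallyCompactSpace_iff.mp this
  have := e.t2Space
  have key : ∀ n : ℕ, locDim (PrimSpec A) ≤ n ↔ coveringDim (UnitizedSpectrum A) ≤ n := by
    intro n
    rw [locDim_le_iff, coveringDim_le_iff]
    constructor
    · intro h
      refine CoverDimLE.of_forall_notMem (infty A) fun C hC hi => ?_
      have hC' : IsCompact (Subtype.val ⁻¹' C : Set ({infty A}ᶜ : Set (UnitizedSpectrum A))) := by
        rw [IsInducing.subtypeVal.isCompact_iff, Subtype.image_preimage_coe,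
          Set.inter_eq_right.mpr fun x hx => ?_]
        · exact hC.isCompact
        · rintro rfl
          exact hi hx
      have := (CoverDimLE.image_iff e.isInducing).mp (h _ (hC'.image e.continuous))
      rw [← CoverDimLE.image_iff IsInducing.subtypeVal, Subtype.image_preimage_coe,
        Set.inter_eq_right.mpr fun x hx => ?_] at this
      · exact this
      · rintro rfl
        exact hi hx
    · intro h C hC
      rw [← e.image_preimage C, CoverDimLE.image_iff e.isInducing,
        ← CoverDimLE.image_iff IsInducing.subtypeVal]
      refine h.mono_closed (IsCompact.isClosed ?_) (Set.subset_univ _)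
      refine IsCompact.image ?_ continuous_subtype_val
      exact e.isClosedEmbedding.isCompact_preimage hC
  exact le_antisymm (ENat.le_of_forall_natCast_le fun n => (key n).mpr)
    (ENat.le_of_forall_natCast_le fun n => (key n).mp)

end CStarAlg

/-! ### Closed embeddings and countable closures -/

theorem coveringDim_le_iff_range {X Y : Type*} [TopologicalSpace X] [TopologicalSpace Y]
    {f : Y → X} (hf : IsInducing f) {n : ℕ} : coveringDim Y ≤ n ↔ CoverDimLE (Set.range f) n := by
  rw [coveringDim_le_iff, ← CoverDimLE.image_iff hf, Set.image_univ]

theorem coveringDim_le_of_isClosedEmbedding {X Y : Type*} [TopologicalSpace X] [TopologicalSpace Y]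
    {f : Y → X} (hf : IsClosedEmbedding f) : coveringDim Y ≤ coveringDim X :=
  ENat.le_of_forall_natCast_le fun _ h => (coveringDim_le_iff_range hf.isInducing).mpr
    ((coveringDim_le_iff.mp h).mono_closed hf.isClosed_range (Set.subset_univ _))

/-- Countable sets have countable closures under countably many finitary operations. -/
theorem Set.Countable.exists_closed_superset {α : Type*} (w : ∀ k, (Fin k → α) → Set α)
    (hw : ∀ k f, (w k f).Countable) {S : Set α} (hS : S.Countable) :
    ∃ T : Set α, S ⊆ T ∧ T.Countable ∧ ∀ k f, (∀ i, f i ∈ T) → w k f ⊆ T := by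
  let next : Set α → Set α := fun T => T ∪ ⋃ k, ⋃ f ∈ {f : Fin k → α | ∀ i, f i ∈ T}, w k f
  let T : ℕ → Set α := fun m => next^[m] S
  have hsucc : ∀ m, T (m + 1) = next (T m) := fun m => Function.iterate_succ_apply' _ _ _
  have hmono : Monotone T := monotone_nat_of_le_succ fun m => by
    rw [hsucc]
    exact Set.subset_union_left
  have hcount : ∀ m, (T m).Countable := by
    intro m
    induction m with
    | zero => exact hS
    | succ m ih =>
      rw [hsucc]
      exact ih.union (Set.countable_iUnion fun k =>
        (Set.countable_pi fun _ : Fin k => ih).biUnion fun f _ => hw k f)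
  refine ⟨⋃ m, T m, Set.subset_iUnion T 0, Set.countable_iUnion hcount, fun k f hf => ?_⟩
  -- The finitely many arguments all occur by a common stage, so the values of `w` appear at the
  -- next one.
  choose m hm using fun i => Set.mem_iUnion.mp (hf i)
  refine subset_trans ?_ (Set.subset_iUnion T (Finset.univ.sup m + 1))
  rw [hsucc]
  refine subset_trans ?_ Set.subset_union_right
  exact Set.subset_iUnion_of_subset k (Set.subset_biUnion_of_mem (u := fun f => w k f)
    fun i => hmono (Finset.le_sup (Finset.mem_univ i)) (hm i))

/-! ### Spectra of quotients, direct sums and unital algebras -/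

namespace UnitizedSpectrum

section

variable {A B : Type*} [NonUnitalCStarAlgebra A] [NonUnitalCStarAlgebra B]

theorem coveringDim_le_of_surjective {φ : A →⋆ₙₐ[ℂ] B} (hφ : Function.Surjective φ) :
    coveringDim (UnitizedSpectrum B) ≤ coveringDim (UnitizedSpectrum A) :=
  coveringDim_le_of_isClosedEmbedding (isClosedEmbedding_comap hφ)

theorem coveringDim_prod :
    coveringDim (UnitizedSpectrum (A × B)) =
      max (coveringDim (UnitizedSpectrum A)) (coveringDim (UnitizedSpectrum B)) := by
  have hfst : Function.Surjective (NonUnitalStarAlgHom.fst ℂ A B) := Prod.fst_surjective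
  have hsnd : Function.Surjective (NonUnitalStarAlgHom.snd ℂ A B) := Prod.snd_surjective
  refine le_antisymm (ENat.le_of_forall_natCast_le fun n h => ?_)
    (max_le (coveringDim_le_of_surjective hfst) (coveringDim_le_of_surjective hsnd))
  rw [max_le_iff, coveringDim_le_iff_range (isClosedEmbedding_comap hfst).isInducing,
    coveringDim_le_iff_range (isClosedEmbedding_comap hsnd).isInducing] at h
  rw [coveringDim_le_iff]
  convert h.1.union h.2 (isClosedEmbedding_comap hfst).isClosed_range
    (isClosedEmbedding_comap hsnd).isClosed_range
  refine (Set.eq_univ_of_forall fun χ => ?_).symm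
  have hsplit : ∀ x : A × B, χ (x : Unitization ℂ (A × B)) =
      χ (((x.1, 0) : A × B) : Unitization ℂ (A × B)) +
      χ (((0, x.2) : A × B) : Unitization ℂ (A × B)) := fun x => by
    rw [← inr_add]
    simp
  by_cases h0 : ∀ a : A, χ (((a, 0) : A × B) : Unitization ℂ (A × B)) = 0
  · refine Or.inr ⟨comap (NonUnitalStarAlgHom.inr ℂ A B) χ, ext_inr fun x => ?_⟩
    rw [comap_apply_inr, comap_apply_inr, hsplit x, h0, zero_add]
    rfl
  -- The product of `χ (a, 0)` and `χ (0, b)` vanishes for every `b`, so `χ` kills the second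
  -- summand and factors through the first.
  · push Not at h0
    obtain ⟨a, ha⟩ := h0
    refine Or.inl ⟨comap (NonUnitalStarAlgHom.inl ℂ A B) χ, ext_inr fun x => ?_⟩
    have : χ (((0, x.2) : A × B) : Unitization ℂ (A × B)) = 0 := by
      refine (mul_eq_zero.mp ?_).resolve_left ha
      rw [← inr_mul, Prod.mk_mul_mk, mul_zero, zero_mul, Prod.mk_zero_zero, Unitization.inr_zero,
        map_zero]
    rw [comap_apply_inr, comap_apply_inr, hsplit x, this, add_zero]
    rfl

/-- The characters of a unital C*-algebra, as characters of its unitization. -/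
noncomputable def ofUnital (B : Type*) [CStarAlgebra B] :
    C(characterSpace ℂ B, UnitizedSpectrum B) :=
  CharacterSpace.compContinuousMap (Unitization.starLift (NonUnitalStarAlgHom.id ℂ B))

theorem ofUnital_apply_inr {B : Type*} [CStarAlgebra B] (χ : characterSpace ℂ B) (b : B) :
    ofUnital B χ (b : Unitization ℂ B) = χ b := by
  change χ (Unitization.starLift (NonUnitalStarAlgHom.id ℂ B) (b : Unitization ℂ B)) = χ b
  rw [← Unitization.starLift_symm_apply_apply, Equiv.symm_apply_apply]
  rfl

theorem ofUnital_injective {B : Type*} [CStarAlgebra B] : Function.Injective (ofUnital B) :=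
  fun χ ψ h => CharacterSpace.ext fun b => by
    rw [← ofUnital_apply_inr, h, ofUnital_apply_inr]

theorem exists_ofUnital_eq {B : Type*} [CStarAlgebra B] {χ : UnitizedSpectrum B}
    (h : χ ≠ infty B) : ∃ ψ, ofUnital B ψ = χ := by
  have h1 : χ ((1 : B) : Unitization ℂ B) = 1 := by
    obtain ⟨b, hb⟩ := exists_ne_zero_of_ne_infty h
    refine mul_right_cancel₀ hb ?_
    rw [← inr_mul, one_mul, one_mul]
  let φ : B →ₐ[ℂ] ℂ := AlgHom.ofLinearMap
    { toFun := fun b => χ (b : Unitization ℂ B)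
      map_add' := inr_add χ
      map_smul' := inr_smul χ } h1 (inr_mul χ)
  refine ⟨CharacterSpace.equivAlgHom.symm φ, ext_inr fun b => ?_⟩
  rw [ofUnital_apply_inr]
  rfl

/-- Besides ∞ there are only the characters of `B` itself, and a single closed point does not affect
the dimension. Used for the unitization of a nonunital algebra. -/
theorem coveringDim_unital (B : Type*) [CStarAlgebra B] :
    coveringDim (UnitizedSpectrum B) = coveringDim (characterSpace ℂ B) := by
  have hemb : IsClosedEmbedding (ofUnital B) :=
    (ofUnital B).continuous.isClosedEmbedding ofUnital_injective
  refine le_antisymm (ENat.le_of_forall_natCast_le fun n h => ?_)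
    (coveringDim_le_of_isClosedEmbedding hemb)
  rw [coveringDim_le_iff_range hemb.isInducing] at h
  rw [coveringDim_le_iff]
  convert h.union (CoverDimLE.of_subsingleton (Set.subsingleton_singleton (a := infty B)))
    hemb.isClosed_range isClosed_singleton
  refine (Set.eq_univ_of_forall fun χ => ?_).symm
  by_cases hχ : χ = infty B
  · exact Or.inr hχ
  · exact Or.inl (exists_ofUnital_eq hχ)

/-- `CoverDimLE.of_approx` through the Gelfand transform. Scalar parts and `A`-parts are measured
separately, since the sum of the two errors bounds the difference at every character. -/
theorem coverDimLE_of_approx (hA : ∀ a b : A, a * b = b * a) {n : ℕ}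
    (h : ∀ (k : ℕ) (x : Fin k → Unitization ℂ A), ∃ y : Fin k → Unitization ℂ A,
      (∀ i, ‖(x i).fst - (y i).fst‖ + ‖(x i).snd - (y i).snd‖ < 1 / 2) ∧
      ((∀ χ : UnitizedSpectrum A, ∃ i, 1 / 2 < (χ (y i)).re) →
        ∃ V : Fin k → Set (UnitizedSpectrum A), (∀ i, IsOpen (V i)) ∧
        (∀ i, ∀ χ ∈ V i, 1 / 2 < (χ (y i)).re) ∧ (∀ χ, ∃ i, χ ∈ V i) ∧
        ∀ χ, {i | χ ∈ V i}.encard ≤ (n : ℕ∞) + 1)) :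
    CoverDimLE (Set.univ : Set (UnitizedSpectrum A)) n := by
  refine CoverDimLE.of_approx fun k p => ?_
  choose x hx using fun i => exists_apply_eq hA (p i)
  obtain ⟨y, hxy, hy⟩ := h k x
  refine ⟨fun i => ⟨fun χ => χ (y i), continuous_apply _⟩, fun i => ?_, hy⟩
  refine lt_of_le_of_lt ?_ (hxy i)
  rw [ContinuousMap.norm_le _ (by positivity)]
  intro χ
  have : (p i - ⟨fun χ => χ (y i), continuous_apply _⟩ : C(UnitizedSpectrum A, ℂ)) χ =
      ((x i).fst - (y i).fst) + χ (((x i).snd - (y i).snd : A) : Unitization ℂ A) := by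
    rw [ContinuousMap.sub_apply, ← hx, ContinuousMap.coe_mk, apply_eq χ (x i), apply_eq χ (y i),
      Unitization.inr_sub, map_sub]
    ring
  rw [this]
  exact (norm_add_le _ _).trans (by gcongr; exact norm_apply_inr_le χ _)

theorem isOpen_half_lt_re (x : Unitization ℂ A) :
    IsOpen {χ : UnitizedSpectrum A | 1 / 2 < (χ x).re} :=
  isOpen_lt continuous_const (Complex.continuous_re.comp (continuous_apply x))

end

end UnitizedSpectrum

/-! ### Ideals and approximating families -/

namespace CStarAlg

open UnitizedSpectrum

variable {A : CStarAlg.{u}}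

/-- The inclusion of a sub-C*-algebra. -/
def Sub.incl (B : A.Sub) : B.toCStarAlg →⋆ₙₐ[ℂ] A where
  toFun := fun b : B.toNonUnitalStarSubalgebra => (b : A)
  map_smul' _ _ := rfl
  map_zero' := rfl
  map_add' _ _ := rfl
  map_mul' _ _ := rfl
  map_star' _ := rfl

theorem Sub.incl_injective (B : A.Sub) : Function.Injective B.incl := Subtype.val_injective

theorem Sub.mul_comm (B : A.Sub) (hA : ∀ a b : A, a * b = b * a) (a b : B.toCStarAlg) :
    a * b = b * a := B.incl_injective (hA _ _)

theorem Sub.comap_incl_apply (B : A.Sub) (χ : UnitizedSpectrum A)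
    (x : Unitization ℂ B.toCStarAlg) :
    comap B.incl χ x = x.fst + χ (B.incl x.snd : Unitization ℂ A) := by
  rw [apply_eq, comap_apply_inr]

/-- A character with `χ j ≠ 0` for some `j` in the ideal is determined by its restriction, because
`χ a = χ (a * j) / χ j`. -/
theorem CIdeal.injOn_comap_incl (J : A.CIdeal) :
    Set.InjOn (comap J.toSub.incl) (comap J.toSub.incl ⁻¹' {infty _}ᶜ) := by
  intro χ hχ ψ _ h
  obtain ⟨j, hj⟩ := exists_ne_zero_of_ne_infty hχ
  refine ext_inr fun a => ?_
  have hmul : a * J.toSub.incl j ∈ J.toTwoSidedIdeal := J.toTwoSidedIdeal.mul_mem_left _ _ j.2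
  have haj : χ ((a * J.toSub.incl j : A) : Unitization ℂ A) =
      ψ ((a * J.toSub.incl j : A) : Unitization ℂ A) := by
    let y : J.toSub.toCStarAlg := ⟨a * J.toSub.incl j, hmul⟩
    have := congr($h (y : Unitization ℂ _))
    rwa [comap_apply_inr, comap_apply_inr] at this
  have hjj : χ (J.toSub.incl j : Unitization ℂ A) = ψ (J.toSub.incl j : Unitization ℂ A) := by
    rw [← comap_apply_inr, h, comap_apply_inr]
  rw [comap_apply_inr] at hj
  refine mul_right_cancel₀ hj ?_
  rw [← inr_mul, haj, inr_mul, hjj]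

/-- Restriction to the ideal sends the characters killing it to ∞ and is injective elsewhere, so
each closed set missing ∞ is homeomorphic to its closed preimage in the spectrum of `A`. -/
theorem CIdeal.coveringDim_le (J : A.CIdeal) (hA : ∀ a b : A, a * b = b * a) :
    coveringDim (UnitizedSpectrum J.toCStarAlg) ≤ coveringDim (UnitizedSpectrum A) := by
  refine ENat.le_of_forall_natCast_le fun n h => ?_
  rw [coveringDim_le_iff] at h ⊢
  refine CoverDimLE.of_forall_notMem (infty _) fun C hC hi => ?_
  let r : C(UnitizedSpectrum A, UnitizedSpectrum J.toCStarAlg) := comap J.toSub.incl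
  have hr : Function.Surjective r :=
    comap_surjective (J.toSub.mul_comm hA) hA J.toSub.incl_injective
  have hC' : IsClosed (r ⁻¹' C) := hC.preimage r.continuous
  have : CompactSpace (r ⁻¹' C) := isCompact_iff_compactSpace.mp hC'.isCompact
  have hemb : IsClosedEmbedding fun x : r ⁻¹' C => r x := by
    refine (r.continuous.comp continuous_subtype_val).isClosedEmbedding ?_
    intro x y hxy
    refine Subtype.ext (J.injOn_comap_incl ?_ ?_ hxy)
    · exact fun h => hi (h ▸ x.2)
    · exact fun h => hi (h ▸ y.2)
  have hrange : Set.range (fun x : r ⁻¹' C => r x) = C := by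
    rw [← Set.image_eq_range, Set.image_preimage_eq _ hr]
  have h1 := CoverDimLE.coveringDim_subtype_iff.mpr (h.mono_closed hC' (Set.subset_univ _))
  rwa [coveringDim_le_iff_range hemb.isInducing, hrange] at h1

theorem Approximates.coveringDim_le {𝒮 : Set A.Sub} (h𝒮 : Approximates 𝒮)
    (hA : ∀ a b : A, a * b = b * a) {n : ℕ}
    (h : ∀ B ∈ 𝒮, coveringDim (UnitizedSpectrum B.toCStarAlg) ≤ n) :
    coveringDim (UnitizedSpectrum A) ≤ n := by
  classical
  rw [coveringDim_le_iff]
  refine coverDimLE_of_approx hA fun k x => ?_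
  obtain ⟨B, hB, hxB⟩ := h𝒮 (Finset.univ.image fun i => (x i).snd) (1 / 2) (by norm_num)
  choose b hbB hb using fun i => hxB (x i).snd (Finset.mem_image_of_mem _ (Finset.mem_univ i))
  -- Scalar parts are kept exactly; only the `A`-parts are approximated. `z` and `y` are the same
  -- elements seen over `B` and over `A`.
  let z : Fin k → Unitization ℂ B.toCStarAlg := fun i =>
    ⟨((x i).fst, (⟨b i, hbB i⟩ : B.toNonUnitalStarSubalgebra))⟩
  let y : Fin k → Unitization ℂ A := fun i => ⟨((x i).fst, b i)⟩
  let r := comap B.incl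
  have hr : Function.Surjective r := comap_surjective (B.mul_comm hA) hA B.incl_injective
  have hry : ∀ i χ, r χ (z i) = χ (y i) := fun i χ => by
    rw [B.comap_incl_apply, apply_eq χ (y i)]
    rfl
  refine ⟨y, fun i => ?_, fun hy => ?_⟩
  · change ‖(x i).fst - (x i).fst‖ + ‖(x i).snd - b i‖ < 1 / 2
    rw [sub_self, norm_zero, zero_add]
    exact hb i
  -- Surjectivity of `r` carries the covering property down to the spectrum of `B`; a preimage under
  -- `r` has the same order at each point as at its image.
  · obtain ⟨V, hVo, hVz, hVc, hVn⟩ := coveringDim_le_iff.mp (h B hB) k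
      (fun i => {χ | 1 / 2 < (χ (z i)).re}) (fun i => isOpen_half_lt_re _) (fun θ _ => by
        obtain ⟨χ, rfl⟩ := hr θ
        obtain ⟨i, hi⟩ := hy χ
        exact ⟨i, by rwa [Set.mem_ofPred_eq, hry]⟩)
    refine ⟨fun i => r ⁻¹' V i, fun i => (hVo i).preimage r.continuous, fun i χ hχ => ?_,
      fun χ => hVc _ trivial, fun χ => hVn _ trivial⟩
    rw [← hry]
    exact hVz i hχ

end CStarAlg

/-! ### Separable subalgebras of no larger dimension -/

namespace UnitizedSpectrum

/-- The shrunk open sets are replaced by nonvanishing sets of finitely many elements, a form that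
survives in any subalgebra whose unitization contains them. -/
theorem exists_bounded_order_witness {A : Type*} [NonUnitalCStarAlgebra A]
    (hA : ∀ a b : A, a * b = b * a) {n : ℕ}
    (hn : CoverDimLE (Set.univ : Set (UnitizedSpectrum A)) n) {k : ℕ} (y : Fin k → Unitization ℂ A)
    (hy : ∀ χ : UnitizedSpectrum A, ∃ i, 1 / 2 < (χ (y i)).re) :
    ∃ h : Fin k → Unitization ℂ A,
      (∀ i (χ : UnitizedSpectrum A), χ (h i) ≠ 0 → 1 / 2 < (χ (y i)).re) ∧
      (∀ χ : UnitizedSpectrum A, ∃ i, χ (h i) ≠ 0) ∧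
      ∀ χ : UnitizedSpectrum A, {i | χ (h i) ≠ 0}.encard ≤ (n : ℕ∞) + 1 := by
  obtain ⟨V, hVo, hVy, hVc, hVn⟩ := hn k (fun i => {χ | 1 / 2 < (χ (y i)).re})
    (fun i => isOpen_half_lt_re _) (fun χ _ => hy χ)
  obtain ⟨f, hf0, hf1⟩ := exists_continuousMap_subordinate hVo fun χ => hVc χ trivial
  choose h hh using fun i => exists_apply_eq hA (f i)
  have hV : ∀ i χ, χ (h i) ≠ 0 → χ ∈ V i := fun i χ hχ => by
    by_contra hne
    exact hχ ((hh i χ).trans (hf0 i χ hne))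
  refine ⟨h, fun i χ hχ => hVy i (hV i χ hχ), fun χ => ?_, fun χ =>
    (Set.encard_le_encard fun i hi => hV i χ hi).trans (hVn χ trivial)⟩
  obtain ⟨i, hi⟩ := hf1 χ
  exact ⟨i, by rw [hh, hi]; exact one_ne_zero⟩

end UnitizedSpectrum

namespace CStarAlg

open UnitizedSpectrum

variable {A : CStarAlg.{u}}

/-- The closure of a set that is closed under the operations up to scalars in a dense set. -/
def Sub.ofClosure (T : Set A) (Q : Set ℂ) (hQ : Dense Q) (h0 : 0 ∈ T)
    (hadd : ∀ a ∈ T, ∀ b ∈ T, a + b ∈ T) (hmul : ∀ a ∈ T, ∀ b ∈ T, a * b ∈ T)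
    (hstar : ∀ a ∈ T, star a ∈ T) (hsmul : ∀ q ∈ Q, ∀ a ∈ T, q • a ∈ T) : A.Sub where
  carrier := closure T
  add_mem' ha hb := map_mem_closure₂ continuous_add ha hb hadd
  zero_mem' := subset_closure h0
  mul_mem' ha hb := map_mem_closure₂ continuous_mul ha hb hmul
  smul_mem' c _ ha := map_mem_closure₂ continuous_smul (hQ c) ha hsmul
  star_mem' ha := map_mem_closure continuous_star ha hstar
  isClosed := isClosed_closure

/-- A Löwenheim–Skolem argument: a countable set closed under the operations and under `h` contains
witnesses for all covers that it defines, and by density these covers suffice for its closure. -/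
theorem exists_separable_sub (hA : ∀ a b : A, a * b = b * a) {n : ℕ}
    (hn : coveringDim (UnitizedSpectrum A) ≤ n) (C : A.Sub)
    (hC : TopologicalSpace.SeparableSpace C.toCStarAlg) :
    ∃ D : A.Sub, TopologicalSpace.SeparableSpace D.toCStarAlg ∧
      C.toNonUnitalStarSubalgebra ≤ D.toNonUnitalStarSubalgebra ∧
      coveringDim (UnitizedSpectrum D.toCStarAlg) ≤ n := by
  rw [coveringDim_le_iff] at hn
  obtain ⟨S₀, hS₀c, hS₀d⟩ := TopologicalSpace.exists_countable_dense C.toCStarAlg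
  obtain ⟨Q, hQc, hQd⟩ := TopologicalSpace.exists_countable_dense ℂ
  -- `h` is total, with meaningless values when the sets given by `y` do not cover, so it can serve
  -- as a closing-off operation.
  choose! h hh using fun k (y : Fin k → Unitization ℂ A) =>
    exists_bounded_order_witness hA hn y
  let inr : A → Unitization ℂ A := Unitization.inr
  let w : ∀ k, (Fin k → Unitization ℂ A) → Set (Unitization ℂ A) := fun k f =>
    (Set.range (h k f) ∪ Set.range fun p : Fin k × Fin k => f p.1 + f p.2) ∪
    ((Set.range fun p : Fin k × Fin k => f p.1 * f p.2) ∪ Set.range fun i => star (f i)) ∪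
    -- Closure under taking `A`-parts ensures that a witness, minus its scalar, belongs to the
    -- subalgebra.
    ((Set.range fun p : Q × Fin k => (p.1 : ℂ) • f p.2) ∪ Set.range fun i => inr (f i).snd)
  have hQ' := hQc.to_subtype
  obtain ⟨T, hST, hTc, hTw⟩ := Set.Countable.exists_closed_superset w
    (fun k f => ((Set.countable_range _).union (Set.countable_range _)).union
      ((Set.countable_range _).union (Set.countable_range _)) |>.union
      ((Set.countable_range _).union (Set.countable_range _)))
    (S := insert 0 (inr '' (C.incl '' S₀) ∪ Unitization.inl '' Q))
    (((hS₀c.image _).image _ |>.union (hQc.image _)).insert 0)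
  have hT0 : 0 ∈ T := hST (Set.mem_insert _ _)
  have hTadd : ∀ a ∈ T, ∀ b ∈ T, a + b ∈ T := fun a ha b hb =>
    hTw 2 ![a, b] (by simp [Fin.forall_fin_two, ha, hb]) (Or.inl (Or.inl (Or.inr ⟨(0, 1), rfl⟩)))
  have hTmul : ∀ a ∈ T, ∀ b ∈ T, a * b ∈ T := fun a ha b hb =>
    hTw 2 ![a, b] (by simp [Fin.forall_fin_two, ha, hb])
      (Or.inl (Or.inr (Or.inl ⟨(0, 1), rfl⟩)))
  have hTstar : ∀ a ∈ T, star a ∈ T := fun a ha =>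
    hTw 1 ![a] (by simp [ha]) (Or.inl (Or.inr (Or.inr ⟨0, rfl⟩)))
  have hTsmul : ∀ q ∈ Q, ∀ a ∈ T, q • a ∈ T := fun q hq a ha =>
    hTw 1 ![a] (by simp [ha]) (Or.inr (Or.inl ⟨(⟨q, hq⟩, 0), rfl⟩))
  have hTsnd : ∀ a ∈ T, inr a.snd ∈ T := fun a ha =>
    hTw 1 ![a] (by simp [ha]) (Or.inr (Or.inr ⟨0, rfl⟩))
  have hTh : ∀ k (f : Fin k → Unitization ℂ A), (∀ i, f i ∈ T) → ∀ i, h k f i ∈ T :=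
    fun k f hf i => hTw k f hf (Or.inl (Or.inl (Or.inl ⟨i, rfl⟩)))
  have hTinl : ∀ q ∈ Q, (Unitization.inl q : Unitization ℂ A) ∈ T := fun q hq =>
    hST (Or.inr (Or.inr ⟨q, hq, rfl⟩))
  let D : A.Sub := Sub.ofClosure (inr ⁻¹' T) Q hQd (by simpa [inr] using hT0)
    (fun a ha b hb => by simpa [inr] using hTadd _ ha _ hb)
    (fun a ha b hb => by simpa [inr] using hTmul _ ha _ hb)
    (fun a ha => by simpa [inr] using hTstar _ ha)
    (fun q hq a ha => by simpa [inr] using hTsmul q hq _ ha)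
  have hDmem : ∀ a, a ∈ D.toNonUnitalStarSubalgebra ↔ a ∈ closure (inr ⁻¹' T) := fun a => Iff.rfl
  refine ⟨D, ?_, fun c hc => ?_, ?_⟩
  · have h1 : (inr ⁻¹' T).Countable := hTc.preimage Unitization.inr_injective
    exact h1.isSeparable.closure.separableSpace
  · rw [hDmem]
    let c' : C.toCStarAlg := (⟨c, hc⟩ : C.toNonUnitalStarSubalgebra)
    have hcont : Continuous C.incl := continuous_subtype_val
    refine closure_mono ?_ (image_closure_subset_closure_image hcont ⟨c', hS₀d c', rfl⟩)
    exact fun a ha => hST (Or.inr (Or.inl ⟨a, ha, rfl⟩))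
  · let r := comap D.incl
    have hr : Function.Surjective r := comap_surjective (D.mul_comm hA) hA D.incl_injective
    rw [coveringDim_le_iff]
    refine coverDimLE_of_approx (D.mul_comm hA) fun k x => ?_
    -- Errors of 1/4 in the scalar part and 1/4 in the `A`-part add up to the allowed 1/2.
    choose q hqQ hq using fun i => Metric.dense_iff.mp hQd (x i).fst (1 / 4) (by norm_num)
    choose t htT ht using fun i => Metric.mem_closure_iff.mp
      ((hDmem _).mp (x i).snd.2) (1 / 4) (by norm_num)
    have hcoe : ∀ a ∈ inr ⁻¹' T, a ∈ D.toNonUnitalStarSubalgebra := fun a ha => subset_closure ha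
    let y' : Fin k → Unitization ℂ D.toCStarAlg := fun i =>
      ⟨(q i, (⟨t i, hcoe _ (htT i)⟩ : D.toNonUnitalStarSubalgebra))⟩
    let y : Fin k → Unitization ℂ A := fun i => Unitization.inl (q i) + inr (t i)
    have hyT : ∀ i, y i ∈ T := fun i => hTadd _ (hTinl _ (hq i)) _ (htT i)
    -- The witnesses for `y`, reread in the unitization of `D`; since `r` is surjective, their
    -- properties over `A` hold over `D`.
    let g' : Fin k → Unitization ℂ D.toCStarAlg := fun i =>
      ⟨((h k y i).fst, (⟨(h k y i).snd, hcoe _ (hTsnd _ (hTh k y hyT i))⟩ :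
        D.toNonUnitalStarSubalgebra))⟩
    have hry : ∀ i χ, r χ (y' i) = χ (y i) := fun i χ => by
      rw [D.comap_incl_apply, apply_eq χ (y i)]
      simp only [y, inr, Unitization.fst_add, Unitization.snd_add, Unitization.fst_inl,
        Unitization.snd_inl, Unitization.fst_inr, Unitization.snd_inr, add_zero, zero_add]
      rfl
    have hrg : ∀ i χ, r χ (g' i) = χ (h k y i) := fun i χ => by
      rw [D.comap_incl_apply, apply_eq χ (h k y i)]
      rfl
    refine ⟨y', fun i => ?_, fun hy' => ?_⟩
    · have h1 : ‖(x i).fst - q i‖ < 1 / 4 := by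
        rw [← dist_eq_norm, dist_comm]
        exact hqQ i
      have h2 : ‖(x i).snd - (y' i).snd‖ < 1 / 4 := by
        have := ht i
        rw [dist_eq_norm] at this
        exact this
      calc _ < (1 / 4 + 1 / 4 : ℝ) := add_lt_add h1 h2
        _ = 1 / 2 := by norm_num
    · obtain ⟨hg1, hg2, hg3⟩ := hh k y fun χ => by
        obtain ⟨i, hi⟩ := hy' (r χ)
        exact ⟨i, by rwa [hry] at hi⟩
      refine ⟨fun i => {θ | θ (g' i) ≠ 0},
        fun i => isOpen_ne_fun (continuous_apply _) continuous_const, fun i θ hθ => ?_,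
        fun θ => ?_, fun θ => ?_⟩
      all_goals obtain ⟨χ, rfl⟩ := hr θ
      · rw [Set.mem_ofPred_eq, hrg] at hθ
        rw [hry]
        exact hg1 i χ hθ
      · obtain ⟨i, hi⟩ := hg2 χ
        exact ⟨i, by rwa [Set.mem_ofPred_eq, hrg]⟩
      · simpa only [Set.mem_ofPred_eq, hrg] using hg3 χ

/-! ### Closure properties of the class and verification of the axioms -/

theorem unitization_mul_comm (hA : ∀ a b : A, a * b = b * a) (x y : Unitization ℂ A) :
    x * y = y * x := by
  let _ : NonUnitalCommCStarAlgebra A := { mul_comm := hA }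
  exact mul_comm x y

theorem isAdmissibleClass_commutative : IsAdmissibleClass commutativeCStarAlgs.{u} where
  iso A B hA := fun ⟨e⟩ a b => e.symm.injective (by rw [map_mul, map_mul]; exact hA _ _)
  ideal A J hA := J.toSub.mul_comm hA
  quotient A J hA := J.quot_mul_comm hA
  directSum A B hA hB := fun a b => Prod.ext (hA _ _) (hB _ _)
  minUnitization A hA := by
    unfold CStarAlg.minUnitization
    split_ifs
    · exact hA
    · exact unitization_mul_comm hA

theorem locDim_minUnitization (hA : ∀ a b : A, a * b = b * a) :
    locDim (PrimSpec A.minUnitization) = locDim (PrimSpec A) := by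
  by_cases h : A.IsUnital
  · rw [minUnitization, if_pos h]
  · rw [minUnitization, if_neg h, locDim_primSpec hA, locDim_primSpec (unitization_mul_comm hA)]
    exact coveringDim_unital (Unitization ℂ A)

theorem locDim_le_of_surjective {B : CStarAlg.{u}} (hA : ∀ a b : A, a * b = b * a)
    (hB : ∀ a b : B, a * b = b * a) {φ : A →⋆ₙₐ[ℂ] B} (hφ : Function.Surjective φ) :
    locDim (PrimSpec B) ≤ locDim (PrimSpec A) := by
  rw [locDim_primSpec hA, locDim_primSpec hB]
  exact coveringDim_le_of_surjective hφ

end CStarAlg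

theorem mainTheorem10 :
    IsDimensionTheory commutativeCStarAlgs.{u}
      (fun A => locDim (PrimSpec A.1)) where
  admissible := CStarAlg.isAdmissibleClass_commutative
  iso_invariant A B := fun ⟨e⟩ => le_antisymm
    (CStarAlg.locDim_le_of_surjective B.2 A.2 (φ := (e.symm : B.1 →⋆ₙₐ[ℂ] A.1)) e.symm.surjective)
    (CStarAlg.locDim_le_of_surjective A.2 B.2 (φ := (e : A.1 →⋆ₙₐ[ℂ] B.1)) e.surjective)
  ideal_le A J := by
    have hJ := CStarAlg.isAdmissibleClass_commutative.ideal A.1 J A.2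
    rw [CStarAlg.locDim_primSpec A.2, CStarAlg.locDim_primSpec hJ]
    exact J.coveringDim_le A.2
  quotient_le A J := CStarAlg.locDim_le_of_surjective A.2 (J.quot_mul_comm A.2) (φ := J.projHom)
    J.proj_surjective
  directSum_eq A B := by
    have hAB := CStarAlg.isAdmissibleClass_commutative.directSum A.1 B.1 A.2 B.2
    rw [CStarAlg.locDim_primSpec A.2, CStarAlg.locDim_primSpec B.2, CStarAlg.locDim_primSpec hAB]
    exact UnitizedSpectrum.coveringDim_prod
  minUnitization_eq A := CStarAlg.locDim_minUnitization A.2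
  approx_le A n 𝒮 h𝒮 h := by
    induction n using ENat.recTopCoe with
    | top => exact le_top
    | coe n =>
      rw [CStarAlg.locDim_primSpec A.2]
      refine h𝒮.coveringDim_le A.2 fun B hB => ?_
      obtain ⟨hBc, hBn⟩ := h B hB
      rwa [CStarAlg.locDim_primSpec hBc] at hBn
  separable A C hC := by
    obtain h | ⟨n, hn⟩ : locDim (PrimSpec A.1) = ⊤ ∨ ∃ n : ℕ, (n : ℕ∞) = locDim (PrimSpec A.1) := by
      rw [or_iff_not_imp_left]
      exact ENat.ne_top_iff_exists.mp
    -- In infinite dimension there is nothing to bound, and `C` itself serves.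
    · exact ⟨C, C.mul_comm A.2, hC, le_rfl, by dsimp only; rw [h]; exact le_top⟩
    · have hle := hn.ge
      rw [CStarAlg.locDim_primSpec A.2] at hle
      obtain ⟨D, hD, hCD, hDn⟩ := CStarAlg.exists_separable_sub A.2 hle C hC
      refine ⟨D, D.mul_comm A.2, hD, hCD, ?_⟩
      dsimp only
      rw [← hn, CStarAlg.locDim_primSpec (D.mul_comm A.2)]
      exact hDn
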